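/- **Conventions.** Rings are associative with identity; modules and ideals are left. A submodule of $M$ is *essential* if it meets every non-zero submodule of $M$ non-trivially; a module is *uniform* if it is non-zero and any two of its non-zero submodules meet non-trivially. A ring *has enough uniform left ideals* if every non-zero left ideal contains a uniform left ideal. The uniform dimension $\operatorname{udim}(M)$ is the supremum of the cardinals $\mathfrak n$ such that $M$ contains an $\mathfrak n$-indexed direct sum of non-zero submodules, and $\operatorname{udim}(B)=\operatorname{udim}({}_BB)$ for a ring $B$. The left singular ideal $\mathcal Z(B)$ is the set of all $b\in B$ whose left annihilator $\{c\in B: cb=0\}$ contains an essential left ideal of $B$. A subring $A$ of a ring $B$ is *nicely essential* if for every finite set $E\subset B$ of non-zero elements there is $a\in A$ with $0\neq ax\in A$ for all $x\in E$. Let $R$ be a ring, $\alpha$ a ring automorphism of $R$, $\delta$ an $\alpha$-derivation of $R$ (additive, with $\delta(ab)=\alpha(a)\delta(b)+\delta(a)b$), and $\mathbb S=R[x;\alpha,\delta]$ the skew polynomial ring, free as a left $R$-module on $\mathbb T(x)=\{x^n:n\in\mathbb N\}$, with $xa=\alpha(a)x+\delta(a)$ for $a\in R$. Put $\deg_x 0=-\infty$.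 A non-zero $f\in\mathbb S$ is *$R$-nice* if all its non-zero coefficients (written on the left) have the same left annihilator in $R$. For a subring $B\subset\mathbb S$ let $\operatorname{Deg}_x(B)$ be the set of $x$-degrees of non-zero elements of $B$ and $d_B=\gcd(\operatorname{Deg}_x(B)\setminus\{0\})$, with $d_B=0$ if $\operatorname{Deg}_x(B)\subset\{0\}$. A *special subextension* of $\mathbb S$ is a subring $B\supset R$ of $\mathbb S$ such that $B=\sum_{m}(B\cap Rx^m)$, $\operatorname{Deg}_x(B)=d_B\mathbb N$, and for every $0\ne m\in\operatorname{Deg}_x(B)$ there are a regular element $v\in R$ with $\lambda=vx^m\in B$, a subring $B_{(m)}$ of $B\cap R$ containing $R$ (so $B_{(m)}=R$), and a ring automorphism $\theta$ of $B_{(m)}$ such that $\deg_x(\lambda p-\theta(p)\lambda)<m$ for all $p\in B_{(m)}$, and for every $q\in R$ with $qx^m\in B$ there is $u\in B_{(m)}$, regular in $R$, with $uqx^m\in B_{(m)}\lambda$. An *essentially special subextension* of $\mathbb S$ is a nicely essential subring $A$ of a prescribed special subextension $\widehat A$ of $\mathbb S$. **Statement.** Let $A$ be an essentially special subextension of $\mathbb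 S=R[x;\alpha,\delta]$, nicely essential in the prescribed special subextension $\widehat A$, and suppose that for every $0\ne a\in R$ the left ideal $\widehat Aa$ of $\widehat A$ contains an $R$-nice polynomial of $x$-degree $d_{\widehat A}$. For a left ideal $L$ of $R$ let $AL$ be the left $A$-submodule of $\mathbb S$ generated by $L$. Then: 1. if $L$ is a uniform left ideal of $R$, then $A\cap AL$ is a uniform left ideal of $A$; if $L$ is an essential left ideal of $R$, then $A\cap AL$ is an essential left ideal of $A$; 2. $\mathcal Z(A)=A\cap \mathcal Z(R)\mathbb T(x)$, where $\mathcal Z(R)\mathbb T(x)$ is the set of all finite sums of elements $ax^n$ with $a\in\mathcal Z(R)$, $n\in\mathbb N$; 3. if $R$ has enough uniform left ideals, then so does $A$, and $\operatorname{udim}(A)=\operatorname{udim}(R)$. -/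

import Mathlib

universe u

/-! ### Essential and uniform submodules, uniform dimension, left singular ideal

All modules are left modules; `Ideal R` is the type of left ideals of `R`. -/

/-- The submodule `N` of `M` is essential: it meets every non-zero submodule of `M`. -/
def IsEssentialSubmodule {R M : Type*} [Ring R] [AddCommGroup M] [Module R M]
    (N : Submodule R M) : Prop :=
  ∀ K : Submodule R M, K ≠ ⊥ → N ⊓ K ≠ ⊥

/-- The submodule `N` is uniform: it is non-zero and any two non-zero submodules of `N` have a
non-zero intersection. -/
def IsUniformSubmodule {R M : Type*} [Ring R] [AddCommGroup M] [Module R M]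
    (N : Submodule R M) : Prop :=
  N ≠ ⊥ ∧ ∀ K K' : Submodule R M, K ≤ N → K' ≤ N → K ≠ ⊥ → K' ≠ ⊥ → K ⊓ K' ≠ ⊥

/-- Every non-zero left ideal of `R` contains a uniform left ideal of `R`. -/
def HasEnoughUniformLeftIdeals (R : Type*) [Ring R] : Prop :=
  ∀ J : Ideal R, J ≠ ⊥ → ∃ U : Ideal R, U ≤ J ∧ IsUniformSubmodule U

/-- The cardinals `c` such that `M` contains a `c`-indexed direct sum of non-zero submodules. -/
def directSumCardinals (R : Type*) (M : Type u) [Ring R] [AddCommGroup M] [Module R M] :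
    Set Cardinal.{u} :=
  {c | ∃ (ι : Type u) (N : ι → Submodule R M),
    iSupIndep N ∧ (∀ i, N i ≠ ⊥) ∧ Cardinal.mk ι = c}

/-- The set of cardinals in the definition of the uniform dimension is bounded, so that its
supremum is a genuine one. -/
theorem bddAbove_directSumCardinals (R : Type*) (M : Type u) [Ring R] [AddCommGroup M]
    [Module R M] : BddAbove (directSumCardinals R M) := by
  refine ⟨Cardinal.mk (Set M), ?_⟩
  rintro c ⟨ι, N, hN, hne, rfl⟩
  refine Cardinal.mk_le_of_injective (f := fun i => (N i : Set M)) ?_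
  intro i j hij
  exact hN.injective hne (SetLike.coe_injective hij)

/-- The uniform (Goldie) dimension of a module, as a (possibly infinite) cardinal. -/
noncomputable def uniformDim (R : Type*) (M : Type u) [Ring R] [AddCommGroup M] [Module R M] :
    Cardinal.{u} :=
  sSup (directSumCardinals R M)

/-- The left annihilator in `R` of an element of `R`. -/
def leftAnn {R : Type*} [Ring R] (a : R) : Ideal R where
  carrier := {r | r * a = 0}
  add_mem' {r s} hr hs := by
    simp only [Set.mem_ofPred_eq] at hr hs ⊢
    rw [add_mul, hr, hs, add_zero]
  zero_mem' := zero_mul a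
  smul_mem' r s hs := by
    simp only [Set.mem_ofPred_eq, smul_eq_mul] at hs ⊢
    rw [mul_assoc, hs, mul_zero]

/-- The left singular ideal of `R` (as a set): the elements whose left annihilator contains an
essential left ideal. -/
def leftSingular (R : Type*) [Ring R] : Set R :=
  {a | ∃ J : Ideal R, IsEssentialSubmodule J ∧ J ≤ leftAnn a}

/-- The subring `A` of the ring `B` (both are subrings of `T`) is a nicely essential subring:
for every finite set `E` of non-zero elements of `B` there is `a ∈ A` with `0 ≠ a x ∈ A` for all
`x ∈ E`. -/
def IsNicelyEssentialSubring {T : Type*} [Ring T] (A B : Subring T) : Prop :=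
  A ≤ B ∧ ∀ E : Finset T, (∀ x ∈ E, x ∈ B ∧ x ≠ 0) → ∃ a ∈ A, ∀ x ∈ E, a * x ≠ 0 ∧ a * x ∈ A

/-! ### The univariate skew polynomial ring `S[x; α, δ]` -/

/-- An `α`-derivation of `S`: an additive map with `δ (a b) = α a * δ b + δ a * b`. -/
structure SkewDerivation {S : Type*} [Ring S] (α : S →+* S) extends S →+ S where
  leibniz' : ∀ a b : S, toFun (a * b) = α a * toFun b + toFun a * b

namespace SkewDerivation

variable {S : Type*} [Ring S] {α : S →+* S} (δ : SkewDerivation α)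

instance : CoeFun (SkewDerivation α) (fun _ => S → S) := ⟨fun d => d.toAddMonoidHom⟩

theorem map_mul (a b : S) : δ (a * b) = α a * δ b + δ a * b := δ.leibniz' a b

theorem map_add (a b : S) : δ (a + b) = δ a + δ b := δ.toAddMonoidHom.map_add a b

theorem map_zero : δ 0 = 0 := δ.toAddMonoidHom.map_zero

theorem map_one : δ 1 = 0 := by
  have h := δ.map_mul 1 1
  simpa using h

end SkewDerivation

/-- The skew polynomial ring (Ore extension) `S[x; α, δ]`: the free left `S`-module on the powers
`x ^ n`, with the multiplication determined by `x a = α a * x + δ a`. -/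
def SkewPoly {S : Type u} [Ring S] (α : S →+* S) (_δ : SkewDerivation α) : Type u := ℕ →₀ S

namespace SkewPoly

variable {S : Type u} [Ring S] {α : S →+* S} {δ : SkewDerivation α}

noncomputable instance : AddCommGroup (SkewPoly α δ) := inferInstanceAs (AddCommGroup (ℕ →₀ S))

noncomputable instance : Module S (SkewPoly α δ) := inferInstanceAs (Module S (ℕ →₀ S))

/-- The coefficient of `x ^ n` (coefficients are written on the left). -/
def coeff (f : SkewPoly α δ) (n : ℕ) : S := (show ℕ →₀ S from f) n

/-- The finite set of exponents with a non-zero coefficient. -/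
def support (f : SkewPoly α δ) : Finset ℕ := Finsupp.support (show ℕ →₀ S from f)

/-- The monomial `a x ^ n`, as an additive map in `a`. -/
noncomputable def monomial (n : ℕ) : S →+ SkewPoly α δ :=
  (Finsupp.singleAddHom n : S →+ (ℕ →₀ S))

@[ext] theorem ext {f g : SkewPoly α δ} (h : ∀ n, f.coeff n = g.coeff n) : f = g :=
  Finsupp.ext h

@[simp] theorem coeff_add (f g : SkewPoly α δ) (n : ℕ) :
    (f + g).coeff n = f.coeff n + g.coeff n := rfl

@[simp] theorem coeff_zero (n : ℕ) : (0 : SkewPoly α δ).coeff n = 0 := rfl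

@[simp] theorem coeff_smul (a : S) (f : SkewPoly α δ) (n : ℕ) :
    (a • f).coeff n = a * f.coeff n := rfl

theorem coeff_monomial (n m : ℕ) (a : S) :
    (monomial n a : SkewPoly α δ).coeff m = if n = m then a else 0 :=
  Finsupp.single_apply

theorem mem_support {f : SkewPoly α δ} {n : ℕ} : n ∈ f.support ↔ f.coeff n ≠ 0 :=
  Finsupp.mem_support_iff

theorem smul_monomial (a b : S) (n : ℕ) :
    a • (monomial n b : SkewPoly α δ) = monomial n (a * b) :=
  Finsupp.smul_single a n b

theorem addHom_ext {M : Type*} [AddMonoid M] {φ ψ : SkewPoly α δ →+ M}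
    (h : ∀ n a, φ (monomial n a) = ψ (monomial n a)) : φ = ψ :=
  Finsupp.addHom_ext h

/-- Left multiplication by `x`: it sends `a x ^ n` to `α a * x ^ (n + 1) + δ a * x ^ n`. -/
noncomputable def mulX : SkewPoly α δ →+ SkewPoly α δ :=
  (Finsupp.liftAddHom fun n : ℕ =>
    ((monomial (n + 1) : S →+ SkewPoly α δ).comp (α : S →+ S) +
      (monomial n : S →+ SkewPoly α δ).comp δ.toAddMonoidHom) :
    (ℕ →₀ S) →+ SkewPoly α δ)

theorem mulX_monomial (n : ℕ) (a : S) :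
    mulX (monomial n a : SkewPoly α δ) = monomial (n + 1) (α a) + monomial n (δ a) := by
  refine (Finsupp.liftAddHom_apply_single _ n a).trans ?_
  rfl

theorem mulX_smul (a : S) (f : SkewPoly α δ) : mulX (a • f) = α a • mulX f + δ a • f := by
  have h : (mulX : SkewPoly α δ →+ SkewPoly α δ).comp (smulAddHom S _ a) =
      (smulAddHom S _ (α a)).comp mulX + smulAddHom S _ (δ a) := by
    refine addHom_ext fun n b => ?_
    simp only [AddMonoidHom.comp_apply, AddMonoidHom.add_apply, smulAddHom_apply,
      smul_monomial, mulX_monomial, _root_.map_mul, SkewDerivation.map_mul, map_add]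
    abel
  exact DFunLike.congr_fun h f

/-- Left multiplication by `x ^ n`. -/
noncomputable def mulXPow : ℕ → SkewPoly α δ →+ SkewPoly α δ
  | 0 => AddMonoidHom.id _
  | n + 1 => mulX.comp (mulXPow n)

theorem mulXPow_zero (f : SkewPoly α δ) : mulXPow 0 f = f := rfl

theorem mulXPow_succ (n : ℕ) (f : SkewPoly α δ) : mulXPow (n + 1) f = mulX (mulXPow n f) := rfl

/-- Left multiplication by `f = ∑ aₙ x ^ n`: it sends `g` to `∑ aₙ • mulXPow n g`. -/
noncomputable def mulLeft : SkewPoly α δ →+ SkewPoly α δ →+ SkewPoly α δ :=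
  (Finsupp.liftAddHom fun n : ℕ =>
    (AddMonoidHom.compHom.flip (mulXPow n)).comp (smulAddHom S (SkewPoly α δ)) :
    (ℕ →₀ S) →+ SkewPoly α δ →+ SkewPoly α δ)

theorem mulLeft_monomial (n : ℕ) (a : S) (f : SkewPoly α δ) :
    mulLeft (monomial n a) f = a • mulXPow n f :=
  DFunLike.congr_fun (Finsupp.liftAddHom_apply_single
    (fun n : ℕ => (AddMonoidHom.compHom.flip (mulXPow n)).comp (smulAddHom S (SkewPoly α δ))) n a) f

theorem mulXPow_one (n : ℕ) :
    mulXPow n (monomial 0 1 : SkewPoly α δ) = monomial n 1 := by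
  induction n with
  | zero => rfl
  | succ n ih =>
    rw [mulXPow_succ, ih, mulX_monomial, _root_.map_one, SkewDerivation.map_one,
      _root_.map_zero, add_zero]

theorem mulLeft_smul (a : S) (f g : SkewPoly α δ) : mulLeft (a • f) g = a • mulLeft f g := by
  have h : (AddMonoidHom.flip mulLeft g).comp (smulAddHom S (SkewPoly α δ) a) =
      (smulAddHom S (SkewPoly α δ) a).comp (AddMonoidHom.flip mulLeft g) := by
    refine addHom_ext fun n b => ?_
    simp only [AddMonoidHom.comp_apply, smulAddHom_apply, AddMonoidHom.flip_apply,
      smul_monomial, mulLeft_monomial, mul_smul]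
  exact DFunLike.congr_fun h f

theorem mulLeft_mulX (f g : SkewPoly α δ) : mulLeft (mulX f) g = mulX (mulLeft f g) := by
  have h : (AddMonoidHom.flip mulLeft g).comp (mulX : SkewPoly α δ →+ SkewPoly α δ) =
      mulX.comp (AddMonoidHom.flip mulLeft g) := by
    refine addHom_ext fun n b => ?_
    simp only [AddMonoidHom.comp_apply, AddMonoidHom.flip_apply, mulX_monomial, map_add,
      mulLeft_monomial, mulX_smul, mulXPow_succ]
  exact DFunLike.congr_fun h f

theorem mulLeft_mulXPow (n : ℕ) (f g : SkewPoly α δ) :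
    mulLeft (mulXPow n f) g = mulXPow n (mulLeft f g) := by
  induction n with
  | zero => rfl
  | succ n ih => rw [mulXPow_succ, mulLeft_mulX, ih, mulXPow_succ]

theorem mulLeft_mulLeft (f g k : SkewPoly α δ) :
    mulLeft (mulLeft f g) k = mulLeft f (mulLeft g k) := by
  have h : (AddMonoidHom.flip mulLeft k).comp (AddMonoidHom.flip mulLeft g) =
      AddMonoidHom.flip mulLeft (mulLeft g k) := by
    refine addHom_ext fun n b => ?_
    simp only [AddMonoidHom.comp_apply, AddMonoidHom.flip_apply, mulLeft_monomial, mulLeft_smul,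
      mulLeft_mulXPow]
  exact DFunLike.congr_fun h f

noncomputable instance : Mul (SkewPoly α δ) := ⟨fun f g => mulLeft f g⟩

noncomputable instance : One (SkewPoly α δ) := ⟨monomial 0 1⟩

theorem mul_def (f g : SkewPoly α δ) : f * g = mulLeft f g := rfl

theorem one_def : (1 : SkewPoly α δ) = monomial 0 1 := rfl

theorem mulLeft_one (f : SkewPoly α δ) : mulLeft f 1 = f := by
  have h : AddMonoidHom.flip mulLeft (1 : SkewPoly α δ) = AddMonoidHom.id _ := by
    refine addHom_ext fun n b => ?_
    rw [AddMonoidHom.flip_apply, mulLeft_monomial, one_def, mulXPow_one,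
      smul_monomial, mul_one, AddMonoidHom.id_apply]
  exact DFunLike.congr_fun h f

noncomputable instance : Ring (SkewPoly α δ) :=
  { (inferInstance : AddCommGroup (SkewPoly α δ)),
    (inferInstance : Mul (SkewPoly α δ)),
    (inferInstance : One (SkewPoly α δ)) with
    left_distrib := fun f g h => _root_.map_add (mulLeft f) g h
    right_distrib := fun f g h => by
      simp only [mul_def, _root_.map_add, AddMonoidHom.add_apply]
    zero_mul := fun f => by
      simp only [mul_def, _root_.map_zero, AddMonoidHom.zero_apply]
    mul_zero := fun f => _root_.map_zero (mulLeft f)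
    mul_assoc := fun f g h => mulLeft_mulLeft f g h
    one_mul := fun f => by
      rw [mul_def, one_def, mulLeft_monomial, one_smul, mulXPow_zero]
    mul_one := fun f => mulLeft_one f }

/-- The inclusion of the coefficient ring. -/
noncomputable def C : S →+* SkewPoly α δ where
  toFun := monomial 0
  map_one' := rfl
  map_zero' := map_zero _
  map_add' := map_add _
  map_mul' a b := by
    rw [mul_def, mulLeft_monomial, mulXPow_zero, smul_monomial]

/-- The variable `x`. -/
noncomputable def X : SkewPoly α δ := monomial 1 1

theorem C_mul (a : S) (f : SkewPoly α δ) : C a * f = a • f := by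
  exact mulLeft_monomial 0 a f

theorem X_mul (f : SkewPoly α δ) : X * f = mulX f := by
  refine (mulLeft_monomial 1 1 f).trans ?_
  rw [one_smul, mulXPow_succ, mulXPow_zero]

theorem X_pow (n : ℕ) : (X : SkewPoly α δ) ^ n = monomial n 1 := by
  induction n with
  | zero => rfl
  | succ n ih =>
    rw [pow_succ', ih, X_mul, mulX_monomial, _root_.map_one, SkewDerivation.map_one, map_zero,
      add_zero]

/-- `monomial n a` is indeed the product `a x ^ n`. -/
theorem monomial_eq (n : ℕ) (a : S) : (monomial n a : SkewPoly α δ) = C a * X ^ n := by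
  rw [X_pow, C_mul, smul_monomial, mul_one]

/-- The defining commutation rule `x a = α a * x + δ a`. -/
theorem X_mul_C (a : S) : (X : SkewPoly α δ) * C a = C (α a) * X + C (δ a) := by
  rw [X_mul]
  refine (mulX_monomial 0 a).trans ?_
  rw [C_mul, X, smul_monomial, mul_one]
  rfl

/-- Every skew polynomial is the sum of its monomials. -/
theorem sum_monomial (f : SkewPoly α δ) :
    ∑ n ∈ f.support, (monomial n (f.coeff n) : SkewPoly α δ) = f :=
  Finsupp.sum_single (show ℕ →₀ S from f)

/-- The `x`-degree, with `degree 0 = ⊥`. -/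
def degree (f : SkewPoly α δ) : WithBot ℕ := f.support.max

/-- The attainable `x`-degrees in `A`: the degrees of the non-zero elements of `A`. -/
def degrees (A : Subring (SkewPoly α δ)) : Set ℕ :=
  {n | ∃ f ∈ A, f.degree = n}

/-- The greatest common divisor of the non-zero attainable degrees; it is `0` if there are none. -/
noncomputable def degreeGcd (A : Subring (SkewPoly α δ)) : ℕ :=
  Nat.setGcd (degrees A \ {0})

/-- `f` is nice with respect to the coefficient ring `S`: it is non-zero and all its non-zero
coefficients have the same left annihilator in `S`. -/
def IsNice (f : SkewPoly α δ) : Prop :=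
  f ≠ 0 ∧ ∀ m ∈ f.support, ∀ n ∈ f.support, leftAnn (f.coeff m) = leftAnn (f.coeff n)

/-- Special subextensions of `S[x; α, δ]`, where `S` is an `R`-ring by means of `i : R → S`:
subrings `A` containing `R` such that `A = ∑ₘ (A ∩ S x ^ m)`, the set of attainable degrees is
`d ℕ`, and every attainable `m ≠ 0` has a special element `v x ^ m ∈ A` with `v` regular in `S`, a
subring `B` of `A ∩ S` containing `R`, and an automorphism `θ` of `B` with
`deg (v x ^ m p - θ p v x ^ m) < m` for `p ∈ B`, such that whenever `q x ^ m ∈ A` there is `u ∈ B`,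
regular in `S`, with `u q x ^ m ∈ B v x ^ m`. -/
structure IsSpecialSubextension {R : Type*} [Ring R] (i : R →+* S)
    (A : Subring (SkewPoly α δ)) : Prop where
  scalar_mem : ∀ r : R, C (i r) ∈ A
  graded : A.toAddSubgroup =
    ⨆ m : ℕ, A.toAddSubgroup ⊓ (monomial m : S →+ SkewPoly α δ).range
  degrees_eq : degrees A = {n | ∃ k : ℕ, n = degreeGcd A * k}
  special : ∀ m ∈ degrees A, m ≠ 0 →
    ∃ (v : S) (B : Subring S) (θ : B ≃+* B),
      IsRegular v ∧ monomial m v ∈ A ∧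
      (∀ r : R, i r ∈ B) ∧ (∀ b ∈ B, C b ∈ A) ∧
      (∀ p : B, (monomial m v * C (p : S) - C (θ p : S) * monomial m v :
        SkewPoly α δ).degree < m) ∧
      (∀ q : S, monomial m q ∈ A →
        ∃ u ∈ B, IsRegular u ∧ ∃ b ∈ B,
          (C u * monomial m q : SkewPoly α δ) = C b * monomial m v)

/-- `A` is an essentially special subextension of `S[x; α, δ]`, with `A'` as its prescribed special
subextension: `A` is a nicely essential subring of the special subextension `A'`. -/
def IsEssentiallySpecialSubextension {R : Type*} [Ring R] (i : R →+* S)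
    (A A' : Subring (SkewPoly α δ)) : Prop :=
  IsSpecialSubextension i A' ∧ IsNicelyEssentialSubring A A'

/-- The left `A`-submodule `A L` of `S[x; α, δ]` generated by a left ideal `L` of `S`. -/
noncomputable def extendIdeal (A : Subring (SkewPoly α δ)) (L : Ideal S) :
    Submodule A (SkewPoly α δ) :=
  Submodule.span A (C '' (L : Set S))

/-- The left ideal `A ∩ A L` of `A`, for a left ideal `L` of `S`. -/
noncomputable def liftIdeal (A : Subring (SkewPoly α δ)) (L : Ideal S) : Ideal A where
  carrier := {a | (a : SkewPoly α δ) ∈ extendIdeal A L}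
  add_mem' ha hb := (extendIdeal A L).add_mem ha hb
  zero_mem' := (extendIdeal A L).zero_mem
  smul_mem' r _ ha := (extendIdeal A L).smul_mem r ha

/-- For a subset `U` of `S`, the additive group `U T(x)` of all finite sums of elements `a x ^ n`
with `a ∈ U` and `n ∈ ℕ`. -/
noncomputable def termSpan (U : Set S) : AddSubgroup (SkewPoly α δ) :=
  AddSubgroup.closure {f | ∃ a ∈ U, ∃ n : ℕ, f = C a * X ^ n}

end SkewPoly

/-! The difficulty is that leading coefficients may cancel in a product, since neither they nor the
constants need be regular. The remedy is the notion `HasGoodLead f m a`: everything in `S` that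
kills the leading coefficient `a` on the left kills all of `f`. For such `f`, left multiplication
cannot tell `f` from the constant `a`. The elements `c * f` and `c * C a` vanish together, and their
leading terms differ only by a shift of the degree by `m` (`HasGoodLead.hasLead_mul`,
`HasGoodLead.mul_eq_zero_iff`). Every non-zero polynomial acquires a good lead after left
multiplication by a scalar.

Write `B` for the special subextension. Nice polynomials have good leads, so the hypothesis on nice
multiples, iterated, lifts any good lead by any multiple of `d`. All degrees in `B` are multiples of
`d`, so any two of its elements can be compared at equal degree. Writing coefficients on the right
shows that leading coefficients of `B L` in degree `m` lie in `α^m(L)`. Uniformity or essentiality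
in `R` can therefore match two leading terms, and subtraction lowers the degree. Two good leads with
equal leading coefficient have the same left annihilator in the polynomial ring, which keeps the
resulting common multiples non-zero.

This settles the ideals `B L` and the singular elements of `B`. Passage to `A` multiplies a relation
on the left by one `a ∈ A` that moves the finitely many multipliers involved into `A` without
killing the product. Finally, an independent family of uniform left ideals of `R` with essential sum
lifts to such a family in `A` with the same index set, and the size of that set is the uniform
dimension. -/

section UniformDimension

/-! ### Uniform dimension as the size of a family of uniform submodules -/

variable {R M : Type*} [Ring R] [AddCommGroup M] [Module R M]

theorem isEssentialSubmodule_iff {N : Submodule R M} :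
    IsEssentialSubmodule N ↔ ∀ x : M, x ≠ 0 → ∃ r : R, r • x ≠ 0 ∧ r • x ∈ N := by
  constructor
  · intro h x hx
    have h1 := h (Submodule.span R {x}) (by simpa using hx)
    obtain ⟨y, hy, hy0⟩ := (Submodule.ne_bot_iff _).1 h1
    obtain ⟨hyN, hyx⟩ := Submodule.mem_inf.1 hy
    obtain ⟨r, rfl⟩ := Submodule.mem_span_singleton.1 hyx
    exact ⟨r, hy0, hyN⟩
  · intro h K hK
    obtain ⟨x, hxK, hx0⟩ := (Submodule.ne_bot_iff _).1 hK
    obtain ⟨r, hr0, hrN⟩ := h x hx0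
    exact (Submodule.ne_bot_iff _).2 ⟨r • x, ⟨hrN, K.smul_mem r hxK⟩, hr0⟩

theorem isUniformSubmodule_iff {N : Submodule R M} :
    IsUniformSubmodule N ↔ N ≠ ⊥ ∧ ∀ x ∈ N, ∀ y ∈ N, x ≠ 0 → y ≠ 0 →
      ∃ r s : R, r • x = s • y ∧ r • x ≠ 0 := by
  refine and_congr_right fun _ => ⟨fun h x hx y hy hx0 hy0 => ?_, fun h K K' hK hK' hK0 hK0' => ?_⟩
  · have h1 := h (Submodule.span R {x}) (Submodule.span R {y}) (by simpa using hx) (by simpa using hy)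
      (by simpa using hx0) (by simpa using hy0)
    obtain ⟨z, hz, hz0⟩ := (Submodule.ne_bot_iff _).1 h1
    obtain ⟨hzx, hzy⟩ := Submodule.mem_inf.1 hz
    obtain ⟨r, rfl⟩ := Submodule.mem_span_singleton.1 hzx
    obtain ⟨s, hs⟩ := Submodule.mem_span_singleton.1 hzy
    exact ⟨r, s, hs.symm, hz0⟩
  · obtain ⟨x, hxK, hx0⟩ := (Submodule.ne_bot_iff _).1 hK0
    obtain ⟨y, hyK, hy0⟩ := (Submodule.ne_bot_iff _).1 hK0'
    obtain ⟨r, s, hrs, hr0⟩ := h x (hK hxK) y (hK' hyK) hx0 hy0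
    exact (Submodule.ne_bot_iff _).2
      ⟨r • x, ⟨K.smul_mem r hxK, hrs ▸ K'.smul_mem s hyK⟩, hr0⟩

/-- Independent elements of a finite direct sum of uniform modules, given by their coordinates,
are at most as many as the summands. -/
theorem card_le_card_of_uniform_coordinates {ι κ : Type*} {U : ι → Submodule R M}
    (hU : ∀ i, IsUniformSubmodule (U i)) (s : Finset ι) :
    ∀ (t : Finset κ) (v : κ → ι → M), (∀ j ∈ t, ∀ i, v j i ∈ U i) →
      (∀ j ∈ t, ∀ i ∉ s, v j i = 0) → (∀ j ∈ t, v j ≠ 0) →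
      (∀ c : κ → R, ∑ j ∈ t, c j • v j = 0 → ∀ j ∈ t, c j • v j = 0) → t.card ≤ s.card := by
  classical
  induction s using Finset.induction_on with
  | empty =>
    intro t v _ hs hne _
    rw [Finset.card_empty, Nat.le_zero, Finset.card_eq_zero, Finset.eq_empty_iff_forall_notMem]
    exact fun j hj => hne j hj (funext fun i => hs j hj i (Finset.notMem_empty i))
  | insert i₀ s hi₀ ih =>
    intro t v hv hs hne hind
    -- Gaussian elimination on coordinate `i₀`. Either every vector has a non-zero multiple
    -- vanishing there, and the coordinate can be dropped, or some `v j₀` is determined up to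
    -- annihilators by it and serves as a pivot.
    by_cases hred : ∀ j ∈ t, ∃ r : R, r • v j ≠ 0 ∧ r • v j i₀ = 0
    · choose! r hr0 hri using hred
      refine (ih t (fun j => r j • v j) (fun j hj i => (U i).smul_mem _ (hv j hj i))
        (fun j hj i hi => ?_) hr0 fun c hc => ?_).trans
          (Finset.card_le_card (Finset.subset_insert _ _))
      · by_cases h : i = i₀
        · subst h; exact hri j hj
        · simp [hs j hj i (by simp [h, hi])]
      · simp only [smul_smul] at hc ⊢
        exact hind (fun j => c j * r j) hc
    · push Not at hred
      obtain ⟨j₀, hj₀, hinj⟩ := hred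
      replace hinj : ∀ r : R, r • v j₀ i₀ = 0 → r • v j₀ = 0 := fun r h => by
        by_contra h'
        exact hinj r h' h
      have hne₀ : v j₀ i₀ ≠ 0 := fun h => hne j₀ hj₀ (by simpa using hinj 1 (by simpa using h))
      have hex : ∀ j ∈ t.erase j₀, ∃ r s : R, r • v j ≠ 0 ∧ r • v j i₀ = s • v j₀ i₀ := by
        intro j hj
        have hjt := Finset.mem_of_mem_erase hj
        by_cases h : v j i₀ = 0
        · exact ⟨1, 0, by simpa using hne j hjt, by simp [h]⟩
        · obtain ⟨r, s, hrs, hr⟩ := (isUniformSubmodule_iff.1 (hU i₀)).2 _ (hv j hjt i₀) _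
            (hv j₀ hj₀ i₀) h hne₀
          exact ⟨r, s, fun h' => hr (by simpa using congrFun h' i₀), hrs⟩
      choose! r q hr0 hrq using hex
      -- A relation among the reduced vectors is a relation among the original ones, with
      -- coefficient `-∑ c j * q j` at the pivot.
      have key : ∀ c : κ → R, ∑ j ∈ t.erase j₀, c j • (r j • v j - q j • v j₀) = 0 →
          ∀ j ∈ t.erase j₀, (c j * r j) • v j = 0 := by
        intro c hc j hj
        have h1 := hind (fun k => if k = j₀ then -∑ j ∈ t.erase j₀, c j * q j else c k * r k) (by
          rw [← Finset.add_sum_erase _ _ hj₀]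
          simp only [if_true, neg_smul, Finset.sum_smul]
          rw [← hc, neg_add_eq_sub, ← Finset.sum_sub_distrib]
          refine Finset.sum_congr rfl fun k hk => ?_
          rw [if_neg (Finset.ne_of_mem_erase hk), smul_sub, smul_smul, smul_smul]) j
            (Finset.mem_of_mem_erase hj)
        simpa only [if_neg (Finset.ne_of_mem_erase hj)] using h1
      have hle := ih (t.erase j₀) (fun j => r j • v j - q j • v j₀)
        (fun j hj i => (U i).sub_mem ((U i).smul_mem _ (hv j (Finset.mem_of_mem_erase hj) i))
          ((U i).smul_mem _ (hv j₀ hj₀ i)))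
        (fun j hj i hi => by
          by_cases h : i = i₀
          · subst h; simpa [sub_eq_zero] using hrq j hj
          · have hi' : i ∉ insert i₀ s := by simp [h, hi]
            simp [hs j (Finset.mem_of_mem_erase hj) i hi', hs j₀ hj₀ i hi'])
        (fun j hj h => hr0 j hj (by
          have := key (Pi.single j 1) (by
            refine Finset.sum_eq_zero fun k _ => ?_
            by_cases hkj : k = j
            · subst hkj; rw [h, smul_zero]
            · rw [Pi.single_eq_of_ne hkj, zero_smul]) j hj
          simpa using this))
        (fun c hc j hj => by
          have h1 := key c hc j hj
          have h2 : (c j * q j) • v j₀ = 0 := hinj _ (by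
            rw [mul_smul, ← hrq j hj, smul_smul]
            exact congrFun h1 i₀)
          simp only [smul_sub, smul_smul, h1, h2, sub_zero])
      rw [Finset.card_erase_of_mem hj₀] at hle
      rw [Finset.card_insert_of_notMem hi₀]
      omega

end UniformDimension

/-- The uniform dimension is the number of terms of an independent family of uniform submodules
whose sum is essential. -/
theorem uniformDim_eq_mk {R : Type*} {M ι : Type u} [Ring R] [AddCommGroup M] [Module R M]
    {U : ι → Submodule R M} (hind : iSupIndep U) (hU : ∀ i, IsUniformSubmodule (U i))
    (hess : IsEssentialSubmodule (⨆ i, U i)) : uniformDim R M = Cardinal.mk ι := by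
  classical
  refine le_antisymm (csSup_le ⟨_, ι, U, hind, fun i => (hU i).1, rfl⟩ ?_)
    (le_csSup (bddAbove_directSumCardinals R M) ⟨ι, U, hind, fun i => (hU i).1, rfl⟩)
  rintro _ ⟨κ, V, hV, hV0, rfl⟩
  -- Essentiality gives each `V j` a non-zero element of `⨁ U i`, to be handled through its
  -- coordinates.
  have hex : ∀ j, ∃ f : ι →₀ M, (∀ i, f i ∈ U i) ∧ f ≠ 0 ∧ (f.sum fun _ x => x) ∈ V j := by
    intro j
    obtain ⟨x, hx, hx0⟩ := (Submodule.ne_bot_iff _).1 (hess (V j) (hV0 j))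
    obtain ⟨hxU, hxV⟩ := Submodule.mem_inf.1 hx
    obtain ⟨f, hf, rfl⟩ := (Submodule.mem_iSup_iff_exists_finsupp _ _).1 hxU
    exact ⟨f, hf, fun h => hx0 (by simp [h]), hxV⟩
  choose f hfU hf0 hfV using hex
  have hcard : ∀ (s : Finset ι) (t : Finset κ), (∀ j ∈ t, (f j).support ⊆ s) →
      t.card ≤ s.card := by
    intro s t hst
    refine card_le_card_of_uniform_coordinates hU s t (fun j i => f j i) (fun j _ => hfU j)
      (fun j hj i hi => by
        by_contra h
        exact hi (hst j hj (Finsupp.mem_support_iff.2 h)))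
      (fun j _ h => hf0 j (DFunLike.coe_injective h)) fun c hc => ?_
    have hsum : ∀ j ∈ t, ((f j).sum fun _ x => x) = ∑ i ∈ s, f j i := fun j hj =>
      Finsupp.sum_of_support_subset _ (hst j hj) _ fun _ _ => rfl
    have hzero : ∑ j ∈ t, c j • ((f j).sum fun _ x => x) = 0 := by
      rw [Finset.sum_congr rfl fun j hj => by rw [hsum j hj, Finset.smul_sum], Finset.sum_comm]
      refine Finset.sum_eq_zero fun i _ => ?_
      simpa using congrFun hc i
    intro j hj
    have h1 := (iSupIndep_iff_finsetSum_eq_zero_imp_eq_zero V).1 hV t _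
      (fun k _ => (V k).smul_mem (c k) (hfV k)) hzero j hj
    rw [hsum j hj, Finset.smul_sum] at h1
    have h2 := (iSupIndep_iff_finsetSum_eq_zero_imp_eq_zero U).1 hind s _
      (fun i _ => (U i).smul_mem (c j) (hfU j i)) h1
    funext i
    by_cases hi : i ∈ s
    · exact h2 i hi
    · have : f j i = 0 := by
        by_contra h
        exact hi (hst j hj (Finsupp.mem_support_iff.2 h))
      simp [this]
  rcases finite_or_infinite ι with hι | hι
  · have := Fintype.ofFinite ι
    rw [Cardinal.mk_fintype ι, ← Finset.card_univ]
    exact Cardinal.card_le_of fun t => hcard Finset.univ t fun _ _ => Finset.subset_univ _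
  -- By `hcard` at most `s.card` indices share the support `s`, so `κ` maps with finite fibres to
  -- the finite subsets of `ι`.
  · refine (Cardinal.mk_le_mk_mul_of_mk_preimage_le (c := Cardinal.aleph0)
      (fun j => (f j).support) fun s => ?_).trans ?_
    · have hfin : ((fun j => (f j).support) ⁻¹' {s}).Finite := by
        by_contra hinf
        obtain ⟨t, ht, htc⟩ := Set.Infinite.exists_subset_card_eq hinf (s.card + 1)
        have := hcard s t fun j hj => (ht hj : (f j).support = s).subset
        omega
      exact (Cardinal.lt_aleph0_iff_set_finite.2 hfin).le
    · rw [Cardinal.mk_finset_of_infinite, Cardinal.mul_aleph0_eq (Cardinal.aleph0_le_mk ι)]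

/-- A module with enough uniform submodules has an independent family of uniform submodules with
an essential sum. -/
theorem exists_iSupIndep_uniform_essential {R : Type*} {M : Type u} [Ring R] [AddCommGroup M]
    [Module R M] (h : ∀ N : Submodule R M, N ≠ ⊥ → ∃ U ≤ N, IsUniformSubmodule U) :
    ∃ (ι : Type u) (U : ι → Submodule R M), iSupIndep U ∧ (∀ i, IsUniformSubmodule (U i)) ∧
      IsEssentialSubmodule (⨆ i, U i) := by
  obtain ⟨T, ⟨hT, hTU⟩, hmax⟩ := zorn_subset
    {T : Set (Submodule R M) | sSupIndep T ∧ ∀ U ∈ T, IsUniformSubmodule U} (by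
      intro c hc hchain
      refine ⟨⋃₀ c, ⟨?_, ?_⟩, fun s hs => Set.subset_sUnion_of_mem hs⟩
      · rw [Set.sUnion_eq_iUnion]
        exact sSupIndep_iUnion_of_directed hchain.directed fun s => (hc s.2).1
      · rintro U ⟨s, hs, hU⟩
        exact (hc hs).2 U hU)
  refine ⟨T, Subtype.val, (sSupIndep_iff T).1 hT, fun U => hTU U U.2, fun K hK hbot => ?_⟩
  rw [← sSup_eq_iSup'] at hbot
  -- If `K` missed the sum, a uniform `U ≤ K` could be adjoined to the maximal family.
  obtain ⟨U, hUK, hU⟩ := h K hK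
  have hdisj : Disjoint (sSup T) U := (disjoint_iff.2 hbot).mono_right hUK
  have hUT : U ∉ T := fun hmem => hU.1 (disjoint_self.1 (hdisj.mono_left (le_sSup hmem)))
  refine hUT (hmax (y := insert U T) ⟨?_, ?_⟩ (Set.subset_insert U T) (Set.mem_insert U T))
  · rintro a (rfl | ha)
    · rw [Set.insert_sdiff_of_mem _ (Set.mem_singleton _)]
      exact hdisj.symm.mono_right (sSup_le_sSup Set.sdiff_subset)
    · refine ((hT ha).disjoint_sup_right_of_disjoint_sup_left
        (hdisj.mono_left (sup_le (le_sSup ha) (sSup_le_sSup Set.sdiff_subset)))).mono_right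
          (sSup_le ?_)
      rintro b ⟨rfl | hb, hba⟩
      · exact le_sup_right
      · exact (le_sSup (show b ∈ T \ {a} from ⟨hb, hba⟩)).trans le_sup_left
  · rintro V (rfl | hV)
    · exact hU
    · exact hTU V hV

/-! ### Leading terms -/

namespace SkewPoly

variable {S : Type u} [Ring S] {α : S →+* S} {δ : SkewDerivation α}

/-- The coefficient of `x ^ n`, as an additive map. -/
def coeffHom (n : ℕ) : SkewPoly α δ →+ S where
  toFun f := f.coeff n
  map_zero' := rfl
  map_add' _ _ := rfl

@[simp] theorem coeff_sub (f g : SkewPoly α δ) (n : ℕ) :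
    (f - g).coeff n = f.coeff n - g.coeff n := map_sub (coeffHom n) f g

theorem coeff_sum {ι : Type*} (s : Finset ι) (f : ι → SkewPoly α δ) (n : ℕ) :
    (∑ i ∈ s, f i).coeff n = ∑ i ∈ s, (f i).coeff n := map_sum (coeffHom n) f s

theorem coeff_mulX_succ (f : SkewPoly α δ) (k : ℕ) :
    (mulX f).coeff (k + 1) = α (f.coeff k) + δ (f.coeff (k + 1)) := by
  have h : (coeffHom (k + 1)).comp (mulX : SkewPoly α δ →+ SkewPoly α δ) =
      (α : S →+ S).comp (coeffHom k) + δ.toAddMonoidHom.comp (coeffHom (k + 1)) := by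
    refine addHom_ext fun n a => ?_
    change (mulX (monomial n a : SkewPoly α δ)).coeff (k + 1) =
      α ((monomial n a : SkewPoly α δ).coeff k) + δ ((monomial n a : SkewPoly α δ).coeff (k + 1))
    rw [mulX_monomial, coeff_add]
    simp only [coeff_monomial, add_left_inj]
    split_ifs <;> simp [SkewDerivation.map_zero]
  exact DFunLike.congr_fun h f

/-- `f` has degree less than `n`. -/
def DegLT (f : SkewPoly α δ) (n : ℕ) : Prop := ∀ k, n ≤ k → f.coeff k = 0

/-- `f` has degree at most `m`, and `a` (possibly zero) is its coefficient at `x ^ m`. -/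
def HasLead (f : SkewPoly α δ) (m : ℕ) (a : S) : Prop := f.coeff m = a ∧ DegLT f (m + 1)

variable {f g : SkewPoly α δ} {m n : ℕ} {a b : S}

theorem DegLT.eq_zero (h : DegLT f 0) : f = 0 := ext fun n => h n n.zero_le

theorem DegLT.hasLead (h : DegLT f (n + 1)) : HasLead f n (f.coeff n) := ⟨rfl, h⟩

theorem exists_degLT (f : SkewPoly α δ) : ∃ n, DegLT f n := by
  refine ⟨f.support.sup id + 1, fun k hk => ?_⟩
  by_contra h
  have : k ≤ f.support.sup id := Finset.le_sup (f := id) (mem_support.2 h)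
  omega

theorem exists_hasLead (hf : f ≠ 0) : ∃ m a, HasLead f m a ∧ a ≠ 0 := by
  obtain ⟨n, hn⟩ := exists_degLT f
  induction n with
  | zero => exact absurd hn.eq_zero hf
  | succ n ih =>
    by_cases h : f.coeff n = 0
    · refine ih fun k hk => ?_
      rcases hk.eq_or_lt with rfl | hk
      · exact h
      · exact hn k hk
    · exact ⟨n, _, hn.hasLead, h⟩

theorem HasLead.ne_zero (h : HasLead f m a) (ha : a ≠ 0) : f ≠ 0 := by
  rintro rfl
  exact ha h.1.symm

theorem HasLead.lt_of_degLT (h : HasLead f m a) (ha : a ≠ 0) (hn : DegLT f n) : m < n := by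
  by_contra hmn
  exact ha (h.1.symm.trans (hn m (not_lt.1 hmn)))

theorem HasLead.unique (h : HasLead f m a) (ha : a ≠ 0) (h' : HasLead f n b) (hb : b ≠ 0) :
    m = n ∧ a = b := by
  have h1 := h.lt_of_degLT ha h'.2
  have h2 := h'.lt_of_degLT hb h.2
  obtain rfl : m = n := by omega
  exact ⟨rfl, h.1.symm.trans h'.1⟩

theorem HasLead.mono (h : HasLead f m a) (hmn : m < n) : HasLead f n 0 :=
  ⟨h.2 n hmn, fun k hk => h.2 k (by omega)⟩

theorem HasLead.sub_degLT (hf : HasLead f m a) (hg : HasLead g m a) : DegLT (f - g) m := by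
  intro k hk
  rcases hk.eq_or_lt with rfl | hk
  · rw [coeff_sub, hf.1, hg.1, sub_self]
  · rw [coeff_sub, hf.2 k hk, hg.2 k hk, sub_self]

theorem HasLead.smul (hf : HasLead f m a) (r : S) : HasLead (r • f) m (r * a) :=
  ⟨by rw [coeff_smul, hf.1], fun k hk => by rw [coeff_smul, hf.2 k hk, mul_zero]⟩

theorem hasLead_sum {ι : Type*} {s : Finset ι} {F : ι → SkewPoly α δ} {c : ι → S}
    (h : ∀ i ∈ s, HasLead (F i) m (c i)) : HasLead (∑ i ∈ s, F i) m (∑ i ∈ s, c i) :=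
  ⟨by rw [coeff_sum]; exact Finset.sum_congr rfl fun i hi => (h i hi).1, fun k hk => by
    rw [coeff_sum]; exact Finset.sum_eq_zero fun i hi => (h i hi).2 k hk⟩

theorem hasLead_C (a : S) : HasLead (C a : SkewPoly α δ) 0 a := by
  refine ⟨?_, fun k hk => ?_⟩
  · exact (coeff_monomial 0 0 a).trans (if_pos rfl)
  · exact (coeff_monomial 0 k a).trans (if_neg (by omega))

theorem HasLead.X_pow_mul (hf : HasLead f m a) (n : ℕ) : HasLead (X ^ n * f) (n + m) (α^[n] a) := by
  induction n with
  | zero => simpa using hf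
  | succ n ih =>
    rw [pow_succ', mul_assoc, X_mul, Function.iterate_succ_apply', show n + 1 + m = n + m + 1 by omega]
    refine ⟨?_, fun k hk => ?_⟩
    · rw [coeff_mulX_succ, ih.1, ih.2 _ le_rfl, SkewDerivation.map_zero, add_zero]
    · obtain ⟨k, rfl⟩ : ∃ l, k = l + 1 := ⟨k - 1, by omega⟩
      rw [coeff_mulX_succ, ih.2 _ (by omega), ih.2 _ (by omega), SkewDerivation.map_zero, map_zero,
        add_zero]

/-- The product `b * α^[n] a` may vanish; allowing zero in `HasLead` keeps the formula
unconditional. -/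
theorem HasLead.mul (hg : HasLead g n b) (hf : HasLead f m a) :
    HasLead (g * f) (n + m) (b * α^[n] a) := by
  have hsum : g * f = ∑ i ∈ Finset.range (n + 1), g.coeff i • (X ^ i * f) := by
    have : g = ∑ i ∈ Finset.range (n + 1), monomial i (g.coeff i) := by
      ext k
      simp only [coeff_sum, coeff_monomial, Finset.sum_ite_eq', Finset.mem_range]
      split_ifs with hk
      · rfl
      · exact hg.2 k (by omega)
    conv_lhs => rw [this]
    rw [Finset.sum_mul]
    exact Finset.sum_congr rfl fun i _ => by rw [monomial_eq, mul_assoc, C_mul]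
  have hlead := hasLead_sum (s := Finset.range (n + 1)) (m := n + m)
    (F := fun i => g.coeff i • (X ^ i * f)) (c := fun i => if i = n then b * α^[n] a else 0)
    fun i hi => by
      have h1 := (hf.X_pow_mul i).smul (g.coeff i)
      split_ifs with hin
      · rw [← hin, ← hg.1, ← hin]; exact h1
      · exact h1.mono (by have := Finset.mem_range.1 hi; omega)
  rw [hsum]
  simpa using hlead

/-! ### Coefficients written on the right -/

/-- Induction on skew polynomials with coefficients written on the right. -/
theorem right_induction (hα : Function.Surjective α) {P : SkewPoly α δ → Prop} (h0 : P 0)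
    (h1 : ∀ n a c, DegLT c n → P c → P (X ^ n * C a + c)) (f : SkewPoly α δ) : P f := by
  obtain ⟨n, hn⟩ := exists_degLT f
  induction n generalizing f with
  | zero => rwa [hn.eq_zero]
  | succ n ih =>
    obtain ⟨a, ha⟩ := hα.iterate n (f.coeff n)
    have hlead : HasLead (X ^ n * C a : SkewPoly α δ) n (f.coeff n) := by
      simpa [ha] using (hasLead_C (δ := δ) a).X_pow_mul n
    have hlt := hn.hasLead.sub_degLT hlead
    have := h1 n a _ hlt (ih _ hlt)
    rwa [add_sub_cancel] at this

/-- The skew polynomials with coefficients, written on the right, in the left ideal `L`. -/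
noncomputable def rightSpan (L : Ideal S) : AddSubgroup (SkewPoly α δ) :=
  AddSubgroup.closure {f | ∃ n : ℕ, ∃ l ∈ L, f = X ^ n * C l}

theorem mul_C_mem_rightSpan (hα : Function.Surjective α) {L : Ideal S} (c : SkewPoly α δ) {l : S}
    (hl : l ∈ L) : c * C l ∈ rightSpan (δ := δ) L := by
  induction c using right_induction hα with
  | h0 => rw [zero_mul]; exact zero_mem _
  | h1 n a c _ ih =>
    rw [add_mul, mul_assoc, ← map_mul]
    exact add_mem (AddSubgroup.subset_closure ⟨n, _, L.mul_mem_left a hl, rfl⟩) ih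

/-- The right-hand group is stable under left multiplication by the whole polynomial ring: move the
coefficients of the multiplier to the right, where the left ideal `L` absorbs them. -/
theorem extendIdeal_le_rightSpan (hα : Function.Surjective α) (A : Subring (SkewPoly α δ))
    {L : Ideal S} (hf : f ∈ extendIdeal A L) : f ∈ rightSpan (δ := δ) L := by
  induction hf using Submodule.span_induction with
  | mem x hx =>
    obtain ⟨l, hl, rfl⟩ := hx
    simpa using mul_C_mem_rightSpan hα 1 hl
  | zero => exact zero_mem _
  | add x y _ _ hx hy => exact add_mem hx hy
  | smul c x _ hx =>
    change (c : SkewPoly α δ) * x ∈ _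
    clear * - hx hα
    induction hx using AddSubgroup.closure_induction with
    | mem x hx =>
      obtain ⟨n, l, hl, rfl⟩ := hx
      rw [← mul_assoc]
      exact mul_C_mem_rightSpan hα _ hl
    | zero => rw [mul_zero]; exact zero_mem _
    | add x y _ _ hx hy => rw [mul_add]; exact add_mem hx hy
    | neg x _ hx => rw [mul_neg]; exact neg_mem hx

/-- Injectivity of `α` prevents the top term `X ^ N * C l` from losing its leading coefficient
`α^[N] l`. -/
theorem exists_coeff_of_mem_rightSpan (hα : Function.Injective α) {L : Ideal S} (hf : f ∈ rightSpan (δ := δ) L)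
    (hlead : HasLead f m a) (ha : a ≠ 0) : ∃ l ∈ L, α^[m] l = a := by
  classical
  have hrep : ∃ w : ℕ →₀ S, (∀ i, w i ∈ L) ∧ w.sum (fun i l => X ^ i * C l) = f := by
    clear hlead
    induction hf using AddSubgroup.closure_induction with
    | mem x hx =>
      obtain ⟨n, l, hl, rfl⟩ := hx
      refine ⟨Finsupp.single n l, fun i => ?_, by simp⟩
      rw [Finsupp.single_apply]
      split_ifs
      exacts [hl, L.zero_mem]
    | zero => exact ⟨0, fun _ => L.zero_mem, Finsupp.sum_zero_index⟩
    | add x y _ _ hx hy =>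
      obtain ⟨v, hv, rfl⟩ := hx
      obtain ⟨w, hw, rfl⟩ := hy
      exact ⟨v + w, fun i => L.add_mem (hv i) (hw i),
        Finsupp.sum_add_index' (by simp) (by simp [mul_add])⟩
    | neg x _ hx =>
      obtain ⟨v, hv, rfl⟩ := hx
      refine ⟨-v, fun i => L.neg_mem (hv i), ?_⟩
      rw [Finsupp.sum_neg_index (by simp), Finsupp.sum, Finsupp.sum, ← Finset.sum_neg_distrib]
      exact Finset.sum_congr rfl fun i _ => by simp
  obtain ⟨w, hw, rfl⟩ := hrep
  obtain hw0 | hw0 := eq_or_ne w 0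
  · subst hw0
    exact absurd Finsupp.sum_zero_index (hlead.ne_zero ha)
  have hne : w.support.Nonempty := Finsupp.support_nonempty_iff.2 hw0
  set N := w.support.max' hne
  have hN : N ∈ w.support := w.support.max'_mem hne
  have h1 : HasLead (w.sum fun i l => (X ^ i * C l : SkewPoly α δ)) N (α^[N] (w N)) := by
    have h2 := hasLead_sum (s := w.support) (m := N)
      (F := fun i => (X ^ i * C (w i) : SkewPoly α δ)) (c := fun i => if i = N then α^[N] (w N) else 0)
      fun i hi => by
        have h3 := (hasLead_C (δ := δ) (w i)).X_pow_mul i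
        rw [add_zero] at h3
        split_ifs with hin
        · subst hin; exact h3
        · exact h3.mono (lt_of_le_of_ne (w.support.le_max' i hi) hin)
    rw [Finset.sum_ite_eq', if_pos hN] at h2
    exact h2
  have h0 : α^[N] (w N) ≠ 0 := fun h0 => Finsupp.mem_support_iff.1 hN
    (hα.iterate N (h0.trans (iterate_map_zero α N).symm))
  obtain ⟨hNm, hNa⟩ := h1.unique h0 hlead ha
  exact ⟨_, hw N, hNm ▸ hNa⟩

theorem exists_coeff_of_mem_extendIdeal (hα : Function.Bijective α) {A : Subring (SkewPoly α δ)}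
    {L : Ideal S} (hf : f ∈ extendIdeal A L) (hlead : HasLead f m a) (ha : a ≠ 0) :
    ∃ l ∈ L, α^[m] l = a :=
  exists_coeff_of_mem_rightSpan hα.injective (extendIdeal_le_rightSpan hα.surjective A hf) hlead ha

/-! ### Good leading terms -/

/-- `f` is non-zero with leading term `a x ^ m`, and its coefficients are annihilated on the left
by the left annihilator of `a`. -/
def HasGoodLead (f : SkewPoly α δ) (m : ℕ) (a : S) : Prop :=
  HasLead f m a ∧ a ≠ 0 ∧ ∀ r : S, r * a = 0 → r • f = 0

theorem HasGoodLead.smul (h : HasGoodLead f m a) {r : S} (hr : r * a ≠ 0) :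
    HasGoodLead (r • f) m (r * a) :=
  ⟨h.1.smul r, hr, fun s hs => by rw [← mul_smul]; exact h.2.2 _ (by rw [mul_assoc, hs])⟩

theorem hasGoodLead_C (ha : a ≠ 0) : HasGoodLead (C a : SkewPoly α δ) 0 a :=
  ⟨hasLead_C a, ha, fun r hr => by rw [← C_mul, ← map_mul, hr, map_zero]⟩

/-- A scalar that kills the leading coefficient but not `f` lowers the degree, so the process stops.
-/
theorem exists_hasGoodLead_smul (h : HasLead f m a) (ha : a ≠ 0) :
    ∃ (r : S) (n : ℕ) (b : S), n ≤ m ∧ HasGoodLead (r • f) n b := by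
  induction m using Nat.strong_induction_on generalizing f a with
  | _ m ih =>
    by_cases hgood : ∀ r : S, r * a = 0 → r • f = 0
    · exact ⟨1, m, a, le_rfl, by rw [one_smul]; exact ⟨h, ha, hgood⟩⟩
    · push Not at hgood
      obtain ⟨r, hra, hrf⟩ := hgood
      obtain ⟨k, b, hk, hb⟩ := exists_hasLead hrf
      have h1 := h.smul r
      rw [hra] at h1
      have hkm : k < m := hk.lt_of_degLT hb fun j hj => by
        rcases hj.eq_or_lt with rfl | hj
        · exact h1.1
        · exact h1.2 j hj
      obtain ⟨s, n, e, hn, he⟩ := ih k hkm hk hb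
      exact ⟨s * r, n, e, by omega, by rwa [mul_smul]⟩

theorem DegLT.hasLead_add {c : SkewPoly α δ} (hc : DegLT c n) (e : S) :
    HasLead (X ^ n * C e + c) n (α^[n] e) := by
  have h1 := (hasLead_C (δ := δ) e).X_pow_mul n
  rw [add_zero] at h1
  exact ⟨by rw [coeff_add, h1.1, hc n le_rfl, add_zero], fun k hk => by
    rw [coeff_add, h1.2 k hk, hc k (by omega), add_zero]⟩

theorem DegLT.mul_eq_zero_of_coeff (hα : Function.Injective α) {c : SkewPoly α δ} {e : S}
    (hc : DegLT c n) (h : ((X ^ n * C e + c) * C a).coeff n = 0) : e * a = 0 := by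
  have h3 := ((hc.hasLead_add e).mul (hasLead_C (δ := δ) a)).1
  rw [add_zero, h, ← iterate_map_mul] at h3
  exact hα.iterate n (h3.symm.trans (iterate_map_zero α n).symm)

theorem X_pow_mul_C_add_mul {c : SkewPoly α δ} {e : S} (h : C e * f = 0) :
    (X ^ n * C e + c) * f = c * f := by
  rw [add_mul, mul_assoc, h, mul_zero, zero_add]

/-- Left multiples of a good skew polynomial look like those of its leading coefficient. -/
theorem HasGoodLead.hasLead_mul (hα : Function.Bijective α) (hf : HasGoodLead f m a)
    (c : SkewPoly α δ) (hc : HasLead (c * C a) n b) : HasLead (c * f) (n + m) b := by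
  induction c using right_induction hα.surjective with
  | h0 =>
    rw [zero_mul] at hc ⊢
    exact ⟨hc.1, fun k _ => rfl⟩
  | h1 i e c hlt ih =>
    have hlead := hlt.hasLead_add e
    -- If `c` has formal degree above `n`, its top right coefficient `e` satisfies `e * a = 0`;
    -- goodness gives `C e * f = 0`, and the top term drops from both products. Otherwise both leads
    -- are read off from `HasLead.mul`.
    rcases lt_or_ge n i with hni | hin
    · have h4 : e * a = 0 := hlt.mul_eq_zero_of_coeff hα.injective (hc.2 i hni)
      rw [X_pow_mul_C_add_mul (by rw [← map_mul, h4, map_zero])] at hc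
      rw [X_pow_mul_C_add_mul (by rw [C_mul, hf.2.2 e h4])]
      exact ih hc
    · obtain ⟨t, ht⟩ : ∃ t, HasLead (X ^ i * C e + c : SkewPoly α δ) n t := by
        rcases hin.eq_or_lt with rfl | hin
        · exact ⟨_, hlead⟩
        · exact ⟨_, hlead.mono hin⟩
      have h5 := ht.mul (hasLead_C (δ := δ) a)
      rw [add_zero] at h5
      have h6 := ht.mul hf.1
      rwa [← h5.1, hc.1] at h6

theorem HasGoodLead.mul_eq_zero_iff (hα : Function.Bijective α) (hf : HasGoodLead f m a)
    (c : SkewPoly α δ) : c * f = 0 ↔ c * C a = 0 := by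
  constructor
  · intro h
    by_contra h0
    obtain ⟨n, b, hb, hb0⟩ := exists_hasLead h0
    exact (hf.hasLead_mul hα c hb).ne_zero hb0 h
  · intro h
    induction c using right_induction hα.surjective with
    | h0 => exact zero_mul f
    | h1 i e c hlt ih =>
      have h4 : e * a = 0 := hlt.mul_eq_zero_of_coeff hα.injective (by rw [h, coeff_zero])
      rw [X_pow_mul_C_add_mul (by rw [← map_mul, h4, map_zero])] at h
      rw [X_pow_mul_C_add_mul (by rw [C_mul, hf.2.2 e h4])]
      exact ih h

/-- A scalar killing `b` kills `c * C a`, hence also `c * f`, because `f` and `C a` have equal left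
annihilators. -/
theorem HasGoodLead.mul (hα : Function.Bijective α) (hf : HasGoodLead f m a)
    {c : SkewPoly α δ} (hc : HasGoodLead (c * C a) n b) : HasGoodLead (c * f) (n + m) b := by
  refine ⟨hf.hasLead_mul hα c hc.1, hc.2.1, fun r hr => ?_⟩
  have := hc.2.2 r hr
  rw [← C_mul, ← mul_assoc] at this ⊢
  exact (hf.mul_eq_zero_iff hα _).2 this

theorem HasLead.degree_eq (h : HasLead f m a) (ha : a ≠ 0) : f.degree = m := by
  refine le_antisymm (Finset.max_le fun k hk => ?_) (Finset.le_max (mem_support.2 (h.1.trans_ne ha)))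
  rw [mem_support] at hk
  by_contra hkm
  exact hk (h.2 k (by simpa using WithBot.coe_lt_coe.1 (not_le.1 hkm)))

theorem hasLead_of_degree_eq (h : f.degree = m) : HasLead f m (f.coeff m) ∧ f.coeff m ≠ 0 := by
  refine ⟨⟨rfl, fun k hk => ?_⟩, mem_support.1 (Finset.mem_of_max h)⟩
  by_contra hk0
  exact absurd hk (not_le_of_gt (Nat.lt_succ_of_le (Finset.le_max_of_eq (mem_support.2 hk0) h)))

theorem IsNice.hasGoodLead (hf : IsNice f) (h : f.degree = m) : HasGoodLead f m (f.coeff m) := by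
  obtain ⟨h1, h2⟩ := hasLead_of_degree_eq h
  refine ⟨h1, h2, fun r hr => ext fun k => ?_⟩
  rw [coeff_smul, coeff_zero]
  by_cases hk : f.coeff k = 0
  · rw [hk, mul_zero]
  · have : r ∈ leftAnn (f.coeff m) := hr
    rwa [hf.2 m (mem_support.2 h2) k (mem_support.2 hk)] at this

end SkewPoly

/-! ### Left ideals generated over a subring with good multiples -/

namespace SkewPoly

variable {S : Type u} [Ring S] {α : S →+* S} {δ : SkewDerivation α}
variable {f g : SkewPoly α δ} {m n d : ℕ} {a b : S} {B : Subring (SkewPoly α δ)}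

theorem mul_mem_extendIdeal {L : Ideal S} {c : SkewPoly α δ} (hc : c ∈ B)
    (hf : f ∈ extendIdeal B L) : c * f ∈ extendIdeal B L :=
  (extendIdeal B L).smul_mem ⟨c, hc⟩ hf

theorem C_mem_extendIdeal {L : Ideal S} (ha : a ∈ L) :
    (C a : SkewPoly α δ) ∈ extendIdeal B L :=
  Submodule.subset_span (Set.mem_image_of_mem _ ha)

theorem extendIdeal_subset (hC : ∀ r, C r ∈ B) {L : Ideal S} (hf : f ∈ extendIdeal B L) :
    f ∈ B := by
  induction hf using Submodule.span_induction with
  | mem x hx =>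
    obtain ⟨l, _, rfl⟩ := hx
    exact hC l
  | zero => exact zero_mem _
  | add x y _ _ hx hy => exact add_mem hx hy
  | smul c x _ hx => exact mul_mem c.2 hx

/-- The subring `B` contains the coefficients, its attainable degrees are multiples of `d`, and
every non-zero coefficient has a left multiple in `B` of degree `d` with a good leading term. -/
structure HasGoodMultiples (B : Subring (SkewPoly α δ)) (d : ℕ) : Prop where
  C_mem : ∀ r, C r ∈ B
  dvd : ∀ {f m a}, f ∈ B → HasLead f m a → a ≠ 0 → d ∣ m
  exists_mul : ∀ {a : S}, a ≠ 0 → ∃ g ∈ B, ∃ b, HasGoodLead (g * C a) d b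

namespace HasGoodMultiples

theorem smul_mem (hB : HasGoodMultiples B d) (r : S) (hf : f ∈ B) : r • f ∈ B := by
  rw [← C_mul]
  exact mul_mem (hB.C_mem r) hf

/-- Each further multiplier is chosen for the current leading coefficient and raises the degree by
`d`. -/
theorem exists_mul_of_dvd (hB : HasGoodMultiples B d) (hα : Function.Bijective α) (ha : a ≠ 0)
    (hn : d ∣ n) : ∃ g ∈ B, ∃ b, HasGoodLead (g * C a) n b := by
  obtain ⟨k, rfl⟩ := hn
  induction k with
  | zero => exact ⟨1, one_mem B, a, by rw [one_mul]; exact hasGoodLead_C ha⟩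
  | succ k ih =>
    obtain ⟨g, hg, b, hb⟩ := ih
    obtain ⟨g', hg', b', hb'⟩ := hB.exists_mul hb.2.1
    refine ⟨g' * g, mul_mem hg' hg, b', ?_⟩
    rw [mul_assoc, Nat.mul_succ, add_comm]
    exact hb.mul hα hb'

/-- A Euclidean descent on the sum of the degrees: raise the shorter element, match leading
coefficients inside `U`, subtract, and compare the difference with the shorter element. -/
theorem exists_mul_eq_mul_of_hasGoodLead (hB : HasGoodMultiples B d) (hα : Function.Bijective α)
    {U : Ideal S} (hU : IsUniformSubmodule U) (hf : f ∈ extendIdeal B U) (hg : g ∈ extendIdeal B U)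
    (hfm : HasGoodLead f m a) (hgn : HasGoodLead g n b) :
    ∃ c ∈ B, ∃ c' ∈ B, c * f = c' * g ∧ c * f ≠ 0 := by
  induction hN : m + n using Nat.strong_induction_on generalizing f g m n a b with
  | _ N ih =>
  wlog hmn : m ≤ n generalizing f g m n a b
  · obtain ⟨c, hc, c', hc', h, h0⟩ := this hg hf hgn hfm (by omega) (by omega)
    exact ⟨c', hc', c, hc, h.symm, h ▸ h0⟩
  have hdvd : d ∣ n - m := Nat.dvd_sub (hB.dvd (extendIdeal_subset hB.C_mem hg) hgn.1 hgn.2.1)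
    (hB.dvd (extendIdeal_subset hB.C_mem hf) hfm.1 hfm.2.1)
  obtain ⟨p, hp, e, he⟩ := hB.exists_mul_of_dvd hα hfm.2.1 hdvd
  have hpf := hfm.mul hα he
  rw [Nat.sub_add_cancel hmn] at hpf
  have hpfU : p * f ∈ extendIdeal B U := mul_mem_extendIdeal hp hf
  obtain ⟨u, hu, rfl⟩ := exists_coeff_of_mem_extendIdeal hα hpfU hpf.1 hpf.2.1
  obtain ⟨w, hw, rfl⟩ := exists_coeff_of_mem_extendIdeal hα hg hgn.1 hgn.2.1
  obtain ⟨r, s, hrs, hr0⟩ := (isUniformSubmodule_iff.1 hU).2 u hu w hw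
    (fun h => hpf.2.1 (by rw [h, iterate_map_zero]))
    (fun h => hgn.2.1 (by rw [h, iterate_map_zero]))
  simp only [smul_eq_mul] at hrs hr0
  have hne : α^[n] r * α^[n] u ≠ 0 := by
    rw [← iterate_map_mul]
    exact fun h => hr0 (hα.injective.iterate n (h.trans (iterate_map_zero α n).symm))
  have heq : α^[n] r * α^[n] u = α^[n] s * α^[n] w := by
    rw [← iterate_map_mul, ← iterate_map_mul, hrs]
  have hf₁ := hpf.smul hne
  have hg₁ := hgn.smul (heq ▸ hne)
  rw [← heq] at hg₁
  rw [← C_mul] at hf₁ hg₁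
  have hq : C (α^[n] r) * p ∈ B := mul_mem (hB.C_mem _) hp
  have ht : C (α^[n] s) ∈ B := hB.C_mem (δ := δ) _
  rw [← mul_assoc] at hf₁
  generalize (C (α^[n] r) * p : SkewPoly α δ) = q at *
  generalize (C (α^[n] s) : SkewPoly α δ) = t at *
  by_cases hh : t * g - q * f = 0
  · exact ⟨q, hq, t, ht, (sub_eq_zero.1 hh).symm, hf₁.1.ne_zero hf₁.2.1⟩
  have hlt := hg₁.1.sub_degLT hf₁.1
  obtain ⟨k, x, hk, hx⟩ := exists_hasLead hh
  obtain ⟨z, k', x', hkk', hx'⟩ := exists_hasGoodLead_smul hk hx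
  rw [← C_mul] at hx'
  have hkn := hk.lt_of_degLT hx hlt
  -- The difference, made good by `z`, has degree `k' < n`, so the sum of degrees has dropped.
  obtain ⟨c, hc, c', hc', hcc, hc0⟩ := ih (m + k') (by omega) hf
    (mul_mem_extendIdeal (hB.C_mem z) (sub_mem (mul_mem_extendIdeal ht hg)
      (mul_mem_extendIdeal hq hf))) hfm hx' rfl
  have hy : c' * C z ∈ B := mul_mem hc' (hB.C_mem z)
  rw [← mul_assoc] at hcc
  generalize c' * C z = y at *
  have hyt : y * (t * g) = (c + y * q) * f := by
    rw [add_mul, hcc]; noncomm_ring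
  refine ⟨c + y * q, add_mem hc (mul_mem hy hq), y * t, mul_mem hy ht, ?_, fun h0 => ?_⟩
  · rw [mul_assoc, hyt]
  · rw [← hyt] at h0
    -- The good leads of `q * f` and `t * g` share their leading coefficient, so `y` kills both or
    -- neither.
    have h1 : y * (q * f) = 0 :=
      (hf₁.mul_eq_zero_iff hα y).2 ((hg₁.mul_eq_zero_iff hα y).1 h0)
    exact hc0 (by rw [hcc, mul_sub, h0, h1, sub_zero])

/-- If `U` is a uniform left ideal of the coefficient ring, then `B U` is uniform. -/
theorem exists_mul_eq_mul (hB : HasGoodMultiples B d) (hα : Function.Bijective α) {U : Ideal S}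
    (hU : IsUniformSubmodule U) (hf : f ∈ extendIdeal B U) (hg : g ∈ extendIdeal B U)
    (hf0 : f ≠ 0) (hg0 : g ≠ 0) :
    ∃ c ∈ B, ∃ c' ∈ B, c * f = c' * g ∧ c * f ≠ 0 := by
  obtain ⟨m, a, hfm, ha⟩ := exists_hasLead hf0
  obtain ⟨n, b, hgn, hb⟩ := exists_hasLead hg0
  obtain ⟨r, _, _, _, hr⟩ := exists_hasGoodLead_smul hfm ha
  obtain ⟨s, _, _, _, hs⟩ := exists_hasGoodLead_smul hgn hb
  rw [← C_mul] at hr hs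
  obtain ⟨c, hc, c', hc', h, h0⟩ := hB.exists_mul_eq_mul_of_hasGoodLead hα hU
    (mul_mem_extendIdeal (hB.C_mem r) hf) (mul_mem_extendIdeal (hB.C_mem s) hg) hr hs
  simp only [← mul_assoc] at h h0
  exact ⟨_, mul_mem hc (hB.C_mem r), _, mul_mem hc' (hB.C_mem s), h, h0⟩

/-- If `L` is an essential left ideal of the coefficient ring, then `B L` is essential in `B`. -/
theorem exists_mul_mem_extendIdeal (hB : HasGoodMultiples B d) (hα : Function.Bijective α)
    {L : Ideal S} (hL : IsEssentialSubmodule L) (hf : f ∈ B) (hf0 : f ≠ 0) :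
    ∃ c ∈ B, c * f ≠ 0 ∧ c * f ∈ extendIdeal B L := by
  obtain ⟨n, hn⟩ := exists_degLT f
  induction n using Nat.strong_induction_on generalizing f with
  | _ n ih =>
  obtain ⟨m', a', hfm', ha'⟩ := exists_hasLead hf0
  obtain ⟨r, m, a, hm, ha⟩ := exists_hasGoodLead_smul hfm' ha'
  have hmn : m < n := by have := hfm'.lt_of_degLT ha' hn; omega
  obtain ⟨a₀, ha₀⟩ := hα.surjective.iterate m a
  obtain ⟨s, hs0, hsL⟩ := isEssentialSubmodule_iff.1 hL a₀ (by
    rintro rfl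
    exact ha.2.1 (by rw [← ha₀, iterate_map_zero]))
  rw [smul_eq_mul] at hs0 hsL
  -- Lifting `s * a₀ ∈ L` to degree `m` gives an element of `B L` whose leading coefficient is
  -- `α^[m] (t * s * a₀)`; the multiple of `f` by `α^[m] (t * s)` and `r` then has the same good
  -- lead, and the difference has degree below `m`.
  obtain ⟨p, hp, b, hb⟩ := hB.exists_mul_of_dvd hα hs0 (hB.dvd (hB.smul_mem r hf) ha.1 ha.2.1)
  obtain ⟨l, hl, hlb⟩ := exists_coeff_of_mem_extendIdeal hα (L := Ideal.span {s * a₀})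
    (mul_mem_extendIdeal hp (C_mem_extendIdeal (Ideal.mem_span_singleton_self _))) hb.1 hb.2.1
  obtain ⟨t, rfl⟩ := Ideal.mem_span_singleton'.1 hl
  have hb' : α^[m] (t * s) * a = b := by
    rw [← hlb, ← ha₀, ← iterate_map_mul, mul_assoc]
  have hf₁ := ha.smul (r := α^[m] (t * s)) (hb' ▸ hb.2.1)
  rw [hb', ← C_mul, ← C_mul, ← mul_assoc] at hf₁
  have hq : C (α^[m] (t * s)) * C r ∈ B := mul_mem (hB.C_mem (δ := δ) _) (hB.C_mem _)
  generalize (C (α^[m] (t * s)) * C r : SkewPoly α δ) = q at *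
  have hpL : p * C (s * a₀) ∈ extendIdeal B L := mul_mem_extendIdeal hp (C_mem_extendIdeal hsL)
  by_cases hh : q * f - p * C (s * a₀) = 0
  · exact ⟨q, hq, hf₁.1.ne_zero hf₁.2.1, by rwa [sub_eq_zero.1 hh]⟩
  obtain ⟨c, hc, hc0, hcL⟩ := ih m hmn (sub_mem (mul_mem hq hf) (mul_mem hp (hB.C_mem _))) hh
    (hf₁.1.sub_degLT hb.1)
  refine ⟨c * q, mul_mem hc hq, fun h0 => ?_, ?_⟩
  · rw [mul_assoc] at h0
    have h1 := (hb.mul_eq_zero_iff hα c).2 ((hf₁.mul_eq_zero_iff hα c).1 h0)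
    exact hc0 (by rw [mul_sub, h0, h1, sub_zero])
  · have := add_mem hcL (mul_mem_extendIdeal hc hpL)
    rwa [mul_sub, sub_add_cancel, ← mul_assoc] at this

/-- If the coefficient ring has enough uniform left ideals, then every non-zero element of `B` has a
multiple generating a uniform left ideal. -/
theorem exists_mul_uniform (hB : HasGoodMultiples B d) (hα : Function.Bijective α)
    (hS : HasEnoughUniformLeftIdeals S) (hf0 : f ≠ 0) :
    ∃ e ∈ B, e * f ≠ 0 ∧ ∀ c ∈ B, ∀ c' ∈ B, c * (e * f) ≠ 0 → c' * (e * f) ≠ 0 →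
      ∃ x ∈ B, ∃ y ∈ B, x * (c * (e * f)) = y * (c' * (e * f)) ∧ x * (c * (e * f)) ≠ 0 := by
  obtain ⟨m', a', hfm', ha'⟩ := exists_hasLead hf0
  obtain ⟨r, m, a, hm, ha⟩ := exists_hasGoodLead_smul hfm' ha'
  obtain ⟨U, hUa, hU⟩ := hS (Ideal.span {a}) (by simpa using ha.2.1)
  obtain ⟨u, hu, hu0⟩ := (Submodule.ne_bot_iff _).1 hU.1
  obtain ⟨s, rfl⟩ := Ideal.mem_span_singleton'.1 (hUa hu)
  have hg := ha.smul hu0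
  rw [← C_mul, ← C_mul, ← mul_assoc] at hg
  have he : C s * C r ∈ B := mul_mem (hB.C_mem (δ := δ) s) (hB.C_mem r)
  generalize (C s * C r : SkewPoly α δ) = e at *
  refine ⟨e, he, hg.1.ne_zero hg.2.1, fun c hc c' hc' h0 h0' => ?_⟩
  -- Equal left annihilators make `B (e * f)` isomorphic to `B u`, which lies in the uniform `B U`.
  have hker := fun z => hg.mul_eq_zero_iff hα z
  rw [Ne, hker] at h0 h0'
  obtain ⟨x, hx, y, hy, hxy, hx0⟩ := hB.exists_mul_eq_mul hα hU
    (mul_mem_extendIdeal hc (C_mem_extendIdeal hu))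
    (mul_mem_extendIdeal hc' (C_mem_extendIdeal hu)) h0 h0'
  refine ⟨x, hx, y, hy, ?_, ?_⟩
  · rw [← sub_eq_zero, ← mul_assoc, ← mul_assoc y, ← sub_mul, hker, sub_mul, mul_assoc, mul_assoc,
      hxy, sub_self]
  · rw [← mul_assoc, Ne, hker, mul_assoc]
    exact hx0

/-- The leading coefficient of a singular element is singular. -/
theorem lead_mem_leftSingular (hB : HasGoodMultiples B d) (hα : Function.Bijective α)
    (hf : ∀ s ∈ B, s ≠ 0 → ∃ c ∈ B, c * s ≠ 0 ∧ c * s * f = 0) (hfm : HasLead f m a) :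
    a ∈ leftSingular S := by
  refine ⟨leftAnn a, isEssentialSubmodule_iff.2 fun s hs => ?_, le_rfl⟩
  obtain ⟨c, hc, hcs, hcf⟩ := hf (C s) (hB.C_mem s) ((hasLead_C s).ne_zero hs)
  obtain ⟨n, b, hb, hb0⟩ := exists_hasLead hcs
  obtain ⟨l, hl, rfl⟩ := exists_coeff_of_mem_extendIdeal hα (L := Ideal.span {s})
    (mul_mem_extendIdeal hc (C_mem_extendIdeal (Ideal.mem_span_singleton_self _))) hb hb0
  obtain ⟨t, rfl⟩ := Ideal.mem_span_singleton'.1 hl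
  refine ⟨t, fun h => hb0 ?_, ?_⟩
  · rw [smul_eq_mul] at h
    rw [h, iterate_map_zero]
  -- In `c * C s * f = 0` the coefficient in degree `n + m` is `α^[n] (t * s * a)`.
  · have h1 := (hb.mul hfm).1
    rw [hcf, coeff_zero, ← iterate_map_mul] at h1
    exact hα.injective.iterate n (h1.symm.trans (iterate_map_zero α n).symm)

end HasGoodMultiples
end SkewPoly

/-! ### Singular elements and nicely essential subrings -/

theorem mem_leftSingular_iff {R : Type*} [Ring R] {a : R} :
    a ∈ leftSingular R ↔ ∀ s : R, s ≠ 0 → ∃ c : R, c * s ≠ 0 ∧ c * s * a = 0 := by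
  constructor
  · rintro ⟨J, hJ, hJa⟩ s hs
    obtain ⟨c, hc0, hcJ⟩ := isEssentialSubmodule_iff.1 hJ s hs
    exact ⟨c, hc0, hJa hcJ⟩
  · exact fun h => ⟨leftAnn a, isEssentialSubmodule_iff.2 h, le_rfl⟩

/-- Every non-zero element of `B` has a non-zero multiple in `B` that annihilates `f` on the left. -/
def IsSingularOver {T : Type*} [Ring T] (B : Subring T) (f : T) : Prop :=
  ∀ s ∈ B, s ≠ 0 → ∃ c ∈ B, c * s ≠ 0 ∧ c * s * f = 0

section NicelyEssential

variable {T : Type*} [Ring T] {A B : Subring T}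

theorem isSingularOver_coe_iff {a : A} : IsSingularOver A (a : T) ↔ a ∈ leftSingular A := by
  rw [mem_leftSingular_iff]
  constructor
  · intro h s hs
    obtain ⟨c, hc, hc0, hca⟩ := h s s.2 fun h' => hs (Subtype.ext h')
    exact ⟨⟨c, hc⟩, fun h' => hc0 (congrArg Subtype.val h'), Subtype.ext hca⟩
  · intro h s hs hs0
    obtain ⟨c, hc0, hca⟩ := h ⟨s, hs⟩ fun h' => hs0 (congrArg Subtype.val h')
    exact ⟨c, c.2, fun h' => hc0 (Subtype.ext h'), congrArg Subtype.val hca⟩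

theorem IsSingularOver.sub {f g : T} (hf : IsSingularOver B f) (hg : IsSingularOver B g) :
    IsSingularOver B (f - g) := by
  intro s hs hs0
  obtain ⟨c, hc, hc0, hcf⟩ := hf s hs hs0
  obtain ⟨e, he, he0, heg⟩ := hg _ (mul_mem hc hs) hc0
  refine ⟨e * c, mul_mem he hc, by rwa [mul_assoc], ?_⟩
  rw [mul_sub, mul_assoc e, heg, mul_assoc, hcf, mul_zero, sub_zero]

theorem IsSingularOver.zero : IsSingularOver B 0 :=
  fun s _ hs0 => ⟨1, one_mem B, by rwa [one_mul], mul_zero _⟩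

theorem IsNicelyEssentialSubring.exists_mul_mem (h : IsNicelyEssentialSubring A B) (E : Finset T)
    (hE : ∀ x ∈ E, x ∈ B) {y : T} (hy : y ∈ B) (hy0 : y ≠ 0) :
    ∃ a ∈ A, a * y ≠ 0 ∧ a * y ∈ A ∧ ∀ x ∈ E, a * x ∈ A := by
  classical
  obtain ⟨a, ha, haE⟩ := h.2 ((insert y E).filter (· ≠ 0)) fun x hx => by
    obtain ⟨hx, hx0⟩ := Finset.mem_filter.1 hx
    rcases Finset.mem_insert.1 hx with rfl | hx
    exacts [⟨hy, hx0⟩, ⟨hE x hx, hx0⟩]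
  obtain ⟨h1, h2⟩ := haE y (by simp [hy0])
  refine ⟨a, ha, h1, h2, fun x hx => ?_⟩
  by_cases hx0 : x = 0
  · rw [hx0, mul_zero]; exact zero_mem A
  · exact (haE x (by simp [hx, hx0])).2

/-- From `A` to `B`, first move `s` into `A`; from `B` to `A`, move the annihilating multiplier into
`A` afterwards. -/
theorem IsNicelyEssentialSubring.isSingularOver_iff (h : IsNicelyEssentialSubring A B) {f : T} :
    IsSingularOver A f ↔ IsSingularOver B f := by
  constructor
  · intro hf s hs hs0
    obtain ⟨a, ha, ha0, haA, -⟩ := h.exists_mul_mem ∅ (by simp) hs hs0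
    obtain ⟨c, hc, hc0, hcf⟩ := hf _ haA ha0
    exact ⟨c * a, mul_mem (h.1 hc) (h.1 ha), by rwa [mul_assoc], by rwa [mul_assoc c]⟩
  · intro hf s hs hs0
    obtain ⟨c, hc, hc0, hcf⟩ := hf s (h.1 hs) hs0
    obtain ⟨a, ha, ha0, -, haA⟩ := h.exists_mul_mem {c} (by simpa using hc)
      (mul_mem hc (h.1 hs)) hc0
    refine ⟨a * c, haA c (by simp), by rwa [mul_assoc], ?_⟩
    rw [mul_assoc a, mul_assoc a, hcf, mul_zero]

end NicelyEssential

/-! ### Transfer to the nicely essential subring -/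

namespace SkewPoly

variable {S : Type u} [Ring S] {α : S →+* S} {δ : SkewDerivation α}
variable {f g : SkewPoly α δ} {m n d : ℕ} {A B : Subring (SkewPoly α δ)}

namespace HasGoodMultiples

theorem isSingularOver_of_mem_termSpan (hB : HasGoodMultiples B d) (hα : Function.Bijective α)
    (hf : f ∈ termSpan (δ := δ) (leftSingular S)) : IsSingularOver B f := by
  induction hf using AddSubgroup.closure_induction with
  | mem x hx =>
    obtain ⟨a, ⟨J, hJ, hJa⟩, n, rfl⟩ := hx
    intro s hs hs0
    obtain ⟨c, hc, hc0, hcJ⟩ := hB.exists_mul_mem_extendIdeal hα hJ hs hs0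
    refine ⟨c, hc, hc0, ?_⟩
    -- `J` kills `a`, hence so does `B J`, which meets every `B s` with `s ≠ 0`.
    suffices h : ∀ y ∈ extendIdeal B J, y * C a = 0 by rw [← mul_assoc, h _ hcJ, zero_mul]
    intro y hy
    induction hy using Submodule.span_induction with
    | mem x hx =>
      obtain ⟨l, hl, rfl⟩ := hx
      rw [← map_mul, show l * a = 0 from hJa hl, map_zero]
    | zero => exact zero_mul _
    | add x y _ _ hx hy => rw [add_mul, hx, hy, add_zero]
    | smul b x _ hx =>
      change (b : SkewPoly α δ) * x * C a = 0
      rw [mul_assoc, hx, mul_zero]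
  | zero => exact .zero
  | add x y _ _ hx hy => simpa using hx.sub (IsSingularOver.zero.sub hy)
  | neg x _ hx => simpa using IsSingularOver.zero.sub hx

theorem isSingularOver_iff (hB : HasGoodMultiples B d) (hα : Function.Bijective α) :
    IsSingularOver B f ↔ f ∈ termSpan (δ := δ) (leftSingular S) := by
  refine ⟨fun hf => ?_, hB.isSingularOver_of_mem_termSpan hα⟩
  obtain ⟨n, hn⟩ := exists_degLT f
  induction n generalizing f with
  | zero => rw [hn.eq_zero]; exact zero_mem _
  | succ n ih =>
    have hterm : C (f.coeff n) * X ^ n ∈ termSpan (δ := δ) (leftSingular S) :=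
      AddSubgroup.subset_closure ⟨_, hB.lead_mem_leftSingular hα hf hn.hasLead, n, rfl⟩
    have hlead : HasLead (C (f.coeff n) * X ^ n : SkewPoly α δ) n (f.coeff n) := by
      rw [← monomial_eq]
      exact ⟨by rw [coeff_monomial, if_pos rfl], fun k hk => by
        rw [coeff_monomial, if_neg (by omega)]⟩
    have := add_mem (ih (hf.sub (hB.isSingularOver_of_mem_termSpan hα hterm))
      (hn.hasLead.sub_degLT hlead)) hterm
    rwa [sub_add_cancel] at this

end HasGoodMultiples

theorem mem_liftIdeal {L : Ideal S} {x : A} :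
    x ∈ liftIdeal A L ↔ (x : SkewPoly α δ) ∈ extendIdeal A L := Iff.rfl

theorem liftIdeal_mono {L L' : Ideal S} (h : L ≤ L') :
    liftIdeal (δ := δ) A L ≤ liftIdeal A L' :=
  fun _ hx => Submodule.span_mono (Set.image_mono h) hx

theorem extendIdeal_mono_subring (h : A ≤ B) {L : Ideal S} (hf : f ∈ extendIdeal A L) :
    f ∈ extendIdeal B L := by
  induction hf using Submodule.span_induction with
  | mem x hx => exact Submodule.subset_span hx
  | zero => exact zero_mem _
  | add x y _ _ hx hy => exact add_mem hx hy
  | smul c x _ hx => exact mul_mem_extendIdeal (h c.2) hx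

/-- An element of `B (∑ U i)` is a finite sum of terms `b * C l` with each `l` in one `U i`. A
multiplier carrying every such `b` and `b * C l` into `A` puts each term into some `A ∩ A (U i)`.
The free factor `b` in the statement lets the induction absorb scalars from `B`. -/
theorem exists_finset_mul_mem_iSup_liftIdeal (hC : ∀ r, C r ∈ B) {ι : Type*} {U : ι → Ideal S}
    (hf : f ∈ extendIdeal B (⨆ i, U i)) :
    ∀ b ∈ B, ∃ E : Finset (SkewPoly α δ), (∀ x ∈ E, x ∈ B) ∧ ∀ a ∈ A, (∀ x ∈ E, a * x ∈ A) →
      ∃ z ∈ ⨆ i, liftIdeal A (U i), (z : SkewPoly α δ) = a * (b * f) := by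
  classical
  have hadd : ∀ x y : SkewPoly α δ,
      (∀ b ∈ B, ∃ E : Finset (SkewPoly α δ), (∀ x ∈ E, x ∈ B) ∧ ∀ a ∈ A, (∀ x ∈ E, a * x ∈ A) →
        ∃ z ∈ ⨆ i, liftIdeal A (U i), (z : SkewPoly α δ) = a * (b * x)) →
      (∀ b ∈ B, ∃ E : Finset (SkewPoly α δ), (∀ x ∈ E, x ∈ B) ∧ ∀ a ∈ A, (∀ x ∈ E, a * x ∈ A) →
        ∃ z ∈ ⨆ i, liftIdeal A (U i), (z : SkewPoly α δ) = a * (b * y)) →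
      ∀ b ∈ B, ∃ E : Finset (SkewPoly α δ), (∀ x ∈ E, x ∈ B) ∧ ∀ a ∈ A, (∀ x ∈ E, a * x ∈ A) →
        ∃ z ∈ ⨆ i, liftIdeal A (U i), (z : SkewPoly α δ) = a * (b * (x + y)) := by
    intro x y hx hy b hb
    obtain ⟨E, hE, hEx⟩ := hx b hb
    obtain ⟨F, hF, hFy⟩ := hy b hb
    refine ⟨E ∪ F, fun z hz => (Finset.mem_union.1 hz).elim (hE z) (hF z), fun a ha h => ?_⟩
    obtain ⟨z, hz, hzx⟩ := hEx a ha fun x hx => h x (Finset.mem_union_left _ hx)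
    obtain ⟨w, hw, hwy⟩ := hFy a ha fun x hx => h x (Finset.mem_union_right _ hx)
    exact ⟨z + w, add_mem hz hw, by rw [Subring.coe_add, hzx, hwy, mul_add, mul_add]⟩
  have hzero : ∀ b ∈ B, ∃ E : Finset (SkewPoly α δ), (∀ x ∈ E, x ∈ B) ∧
      ∀ a ∈ A, (∀ x ∈ E, a * x ∈ A) →
        ∃ z ∈ ⨆ i, liftIdeal A (U i), (z : SkewPoly α δ) = a * (b * 0) :=
    fun b _ => ⟨∅, by simp, fun a _ _ => ⟨0, zero_mem _, by simp⟩⟩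
  induction hf using Submodule.span_induction with
  | mem x hx =>
    obtain ⟨l, hl, rfl⟩ := hx
    induction hl using Submodule.iSup_induction' with
    | mem i l hl =>
      intro b hb
      refine ⟨{b, b * C l}, by simpa using ⟨hb, mul_mem hb (hC l)⟩, fun a _ h => ?_⟩
      refine ⟨⟨a * (b * C l), h _ (by simp)⟩, Submodule.mem_iSup_of_mem i ?_, rfl⟩
      rw [mem_liftIdeal]
      change a * (b * C l) ∈ _
      rw [← mul_assoc]
      exact mul_mem_extendIdeal (h b (by simp)) (C_mem_extendIdeal hl)
    | zero => rwa [map_zero]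
    | add x y _ _ hx hy => rw [map_add]; exact hadd _ _ hx hy
  | zero => exact hzero
  | add x y _ _ hx hy => exact hadd x y hx hy
  | smul c x _ hx =>
    intro b hb
    obtain ⟨E, hE, hEx⟩ := hx (b * c) (mul_mem hb c.2)
    refine ⟨E, hE, fun a ha h => ?_⟩
    obtain ⟨z, hz, hzx⟩ := hEx a ha h
    exact ⟨z, hz, by rw [hzx, mul_assoc]; rfl⟩

theorem isEssential_iSup_liftIdeal (hB : HasGoodMultiples B d) (hα : Function.Bijective α)
    (hAB : IsNicelyEssentialSubring A B) {ι : Type*} {U : ι → Ideal S}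
    (hU : IsEssentialSubmodule (⨆ i, U i)) :
    IsEssentialSubmodule (⨆ i, liftIdeal (δ := δ) A (U i)) := by
  classical
  refine isEssentialSubmodule_iff.2 fun x hx => ?_
  have hx0 : (x : SkewPoly α δ) ≠ 0 := fun h => hx (Subtype.ext h)
  obtain ⟨c, hc, hc0, hcU⟩ := hB.exists_mul_mem_extendIdeal hα hU (hAB.1 x.2) hx0
  obtain ⟨E, hE, hEx⟩ := exists_finset_mul_mem_iSup_liftIdeal (A := A) hB.C_mem hcU 1 (one_mem B)
  obtain ⟨a, ha, ha0, -, haE⟩ := hAB.exists_mul_mem (insert c E)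
    (by simpa using ⟨hc, hE⟩) (mul_mem hc (hAB.1 x.2)) hc0
  obtain ⟨z, hz, hzx⟩ := hEx a ha fun x hx => haE x (by simp [hx])
  have heq : (⟨a * c, haE c (by simp)⟩ : A) • x = z := by
    refine Subtype.ext ?_
    rw [hzx, one_mul, ← mul_assoc]
    rfl
  refine ⟨_, ?_, heq ▸ hz⟩
  rw [heq]
  rintro rfl
  exact ha0 (by simpa using hzx.symm)

theorem isUniform_liftIdeal (hB : HasGoodMultiples B d) (hα : Function.Bijective α)
    (hAB : IsNicelyEssentialSubring A B) {U : Ideal S} (hU : IsUniformSubmodule U) :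
    IsUniformSubmodule (liftIdeal (δ := δ) A U) := by
  classical
  refine isUniformSubmodule_iff.2 ⟨?_, fun x hx y hy hx0 hy0 => ?_⟩
  · obtain ⟨u, hu, hu0⟩ := (Submodule.ne_bot_iff _).1 hU.1
    obtain ⟨a, ha, ha0, haA, -⟩ := hAB.exists_mul_mem ∅ (by simp) (hB.C_mem u)
      ((hasLead_C u).ne_zero hu0)
    exact (Submodule.ne_bot_iff _).2 ⟨⟨a * C u, haA⟩, mul_mem_extendIdeal ha (C_mem_extendIdeal hu),
      fun h => ha0 (congrArg Subtype.val h)⟩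
  · obtain ⟨c, hc, c', hc', h, h0⟩ := hB.exists_mul_eq_mul hα hU
      (extendIdeal_mono_subring hAB.1 hx) (extendIdeal_mono_subring hAB.1 hy)
      (fun h => hx0 (Subtype.ext h)) (fun h => hy0 (Subtype.ext h))
    obtain ⟨a, ha, ha0, -, haA⟩ := hAB.exists_mul_mem {c, c'} (by simpa using ⟨hc, hc'⟩)
      (mul_mem hc (hAB.1 x.2)) h0
    refine ⟨⟨a * c, haA c (by simp)⟩, ⟨a * c', haA c' (by simp)⟩, Subtype.ext ?_, fun h' => ha0 ?_⟩
    · change a * c * (x : SkewPoly α δ) = a * c' * y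
      rw [mul_assoc, h, mul_assoc]
    · rw [← mul_assoc]
      exact congrArg Subtype.val h'

/-- A common non-zero element would have leading coefficient `α^[m] l` with `l` both in `U i` and in
the sum of the others. -/
theorem iSupIndep_liftIdeal (hα : Function.Bijective α) {ι : Type*} {U : ι → Ideal S}
    (hU : iSupIndep U) : iSupIndep fun i => liftIdeal (δ := δ) A (U i) := by
  refine fun i => Submodule.disjoint_def.2 fun x hx hx' => ?_
  have hx'' : x ∈ liftIdeal A (⨆ (j) (_ : j ≠ i), U j) :=
    (iSup₂_le fun j hj => liftIdeal_mono (le_iSup₂_of_le j hj le_rfl) :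
      (⨆ (j) (_ : j ≠ i), liftIdeal A (U j)) ≤ _) hx'
  by_contra hx0
  obtain ⟨m, a, hm, ha⟩ := exists_hasLead fun h : (x : SkewPoly α δ) = 0 => hx0 (Subtype.ext h)
  obtain ⟨l, hl, hla⟩ := exists_coeff_of_mem_extendIdeal hα hx hm ha
  obtain ⟨l', hl', hla'⟩ := exists_coeff_of_mem_extendIdeal hα hx'' hm ha
  obtain rfl : l = l' := hα.injective.iterate m (hla.trans hla'.symm)
  have hl0 : l = 0 := Submodule.disjoint_def.1 (hU i) l hl hl'
  exact ha (by rw [← hla, hl0, iterate_map_zero])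

theorem hasEnoughUniformLeftIdeals (hB : HasGoodMultiples B d) (hα : Function.Bijective α)
    (hAB : IsNicelyEssentialSubring A B) (hS : HasEnoughUniformLeftIdeals S) :
    HasEnoughUniformLeftIdeals A := by
  classical
  intro J hJ
  obtain ⟨f, hfJ, hf0⟩ := (Submodule.ne_bot_iff _).1 hJ
  obtain ⟨e, he, he0, hunif⟩ := hB.exists_mul_uniform hα hS fun h => hf0 (Subtype.ext h)
  obtain ⟨a, ha, ha0, -, haA⟩ := hAB.exists_mul_mem {e} (by simpa using he)
    (mul_mem he (hAB.1 f.2)) he0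
  have hae := haA e (by simp)
  have hw0 : (⟨a * e, hae⟩ : A) * f ≠ 0 := fun h => ha0 (by
    rw [← mul_assoc]; exact congrArg Subtype.val h)
  have hw : ∀ r : A, (↑(r * (⟨a * e, hae⟩ * f)) : SkewPoly α δ) = r * a * (e * f) := fun r => by
    change (r : SkewPoly α δ) * (a * e * f) = _
    simp only [mul_assoc]
  refine ⟨Ideal.span {⟨a * e, hae⟩ * f}, ?_, isUniformSubmodule_iff.2 ⟨by simpa using hw0, ?_⟩⟩
  · rw [Ideal.span_singleton_le_iff_mem]
    exact J.mul_mem_left _ hfJ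
  · intro x hx y hy hx0 hy0
    obtain ⟨r, rfl⟩ := Ideal.mem_span_singleton'.1 hx
    obtain ⟨s, rfl⟩ := Ideal.mem_span_singleton'.1 hy
    obtain ⟨p, hp, q, hq, hpq, hp0⟩ := hunif (r * a) (mul_mem (hAB.1 r.2) (hAB.1 ha)) (s * a)
      (mul_mem (hAB.1 s.2) (hAB.1 ha)) (fun h => hx0 (Subtype.ext ((hw r).trans h)))
      (fun h => hy0 (Subtype.ext ((hw s).trans h)))
    rw [← hw, ← hw] at hpq
    rw [← hw] at hp0
    obtain ⟨t, ht, ht0, -, htA⟩ := hAB.exists_mul_mem {p, q} (by simpa using ⟨hp, hq⟩)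
      (mul_mem hp (hAB.1 (Subtype.prop _))) hp0
    refine ⟨⟨t * p, htA p (by simp)⟩, ⟨t * q, htA q (by simp)⟩, Subtype.ext ?_, fun h => ht0 ?_⟩
    · change t * p * _ = t * q * _
      rw [mul_assoc, hpq, mul_assoc]
    · rw [← mul_assoc]
      exact congrArg Subtype.val h

end SkewPoly

theorem mainTheorem12 {R : Type u} [Ring R] (α : R →+* R) (hα : Function.Bijective α)
    (δ : SkewDerivation α) (A A' : Subring (SkewPoly α δ))
    (hA : SkewPoly.IsEssentiallySpecialSubextension (RingHom.id R) A A')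
    (hnice : ∀ a : R, a ≠ 0 → ∃ g ∈ A', SkewPoly.IsNice (g * SkewPoly.C a) ∧
      SkewPoly.degree (g * SkewPoly.C a) = (SkewPoly.degreeGcd A' : WithBot ℕ)) :
    (∀ L : Ideal R, IsUniformSubmodule L → IsUniformSubmodule (SkewPoly.liftIdeal A L)) ∧
    (∀ L : Ideal R, IsEssentialSubmodule L → IsEssentialSubmodule (SkewPoly.liftIdeal A L)) ∧
    (Subtype.val '' leftSingular A =
      (A : Set (SkewPoly α δ)) ∩ ((SkewPoly.termSpan (leftSingular R) : AddSubgroup (SkewPoly α δ)) : Set (SkewPoly α δ))) ∧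
    (HasEnoughUniformLeftIdeals R →
      HasEnoughUniformLeftIdeals A ∧ uniformDim A A = uniformDim R R) := by
  obtain ⟨hspec, hAB⟩ := hA
  have hB : SkewPoly.HasGoodMultiples A' (SkewPoly.degreeGcd A') :=
    { C_mem := hspec.scalar_mem
      dvd := fun {f m a} hf hm ha => by
        have hmem : m ∈ SkewPoly.degrees A' := ⟨f, hf, hm.degree_eq ha⟩
        rw [hspec.degrees_eq] at hmem
        exact hmem
      exists_mul := fun {a} ha => by
        obtain ⟨g, hg, hgn, hgd⟩ := hnice a ha
        exact ⟨g, hg, _, hgn.hasGoodLead hgd⟩ }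
  refine ⟨fun L hL => SkewPoly.isUniform_liftIdeal hB hα hAB hL, fun L hL => ?_, ?_, fun hR => ?_⟩
  -- A single left ideal is a family indexed by `Unit`.
  · simpa using SkewPoly.isEssential_iSup_liftIdeal hB hα hAB (U := fun _ : Unit => L)
      (by simpa using hL)
  · ext f
    constructor
    · rintro ⟨a, ha, rfl⟩
      exact ⟨a.2, (hB.isSingularOver_iff hα).1
        (hAB.isSingularOver_iff.1 (isSingularOver_coe_iff.2 ha))⟩
    · rintro ⟨hfA, hf⟩
      exact ⟨⟨f, hfA⟩, isSingularOver_coe_iff.1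
        (hAB.isSingularOver_iff.2 ((hB.isSingularOver_iff hα).2 hf)), rfl⟩
  · refine ⟨SkewPoly.hasEnoughUniformLeftIdeals hB hα hAB hR, ?_⟩
    -- The same index set computes both dimensions.
    obtain ⟨ι, U, hind, hU, hess⟩ := exists_iSupIndep_uniform_essential hR
    rw [uniformDim_eq_mk hind hU hess]
    exact uniformDim_eq_mk (SkewPoly.iSupIndep_liftIdeal hα hind)
      (fun i => SkewPoly.isUniform_liftIdeal hB hα hAB (hU i))
      (SkewPoly.isEssential_iSup_liftIdeal hB hα hAB hess)
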